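/- For a finite group $G$ let $\rho(G)=\prod_{g\in G} o(g)$ be the product of the orders of its elements, and write $\rho(G)=p_1^{\alpha_1}p_2^{\alpha_2}\cdots p_k^{\alpha_k}$ with distinct primes $p_1,\dots,p_k$ and all $\alpha_i\ge 1$. Let ${\rm Exp}_\rho(G)=\{\alpha_1,\alpha_2,\dots,\alpha_k\}$ be the set of exponents in this factorization. **Theorem.** We have ${\rm Exp}_\rho({\rm PSL}(2,11))=\{120,165,220,264\}$. A finite group $G$ is isomorphic to ${\rm PSL}(2,11)$ if and only if ${\rm Exp}_\rho(G)={\rm Exp}_\rho({\rm PSL}(2,11))$. -/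

import Mathlib

/-- The set of exponents `{α₁, …, α_k}` in the prime factorization
`n = p₁ ^ α₁ * ⋯ * p_k ^ α_k` of a positive integer `n`, where `p₁, …, p_k` are the distinct
prime divisors of `n`. It is empty for `n = 1`. -/
def primeExponents (n : ℕ) : Finset ℕ :=
  n.primeFactors.image fun p => n.factorization p

/-- The product of the element orders of a finite group. -/
noncomputable def prodElementOrders (G : Type*) [Group G] [Finite G] : ℕ :=
  ∏ᶠ g : G, orderOf g

/-- The set of exponents in the prime factorization of the product of the element orders
of a finite group. -/
noncomputable def expRho (G : Type*) [Group G] [Finite G] : Finset ℕ :=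
  primeExponents (prodElementOrders G)

/-- `PSL(2, 11)`: the quotient of `SL(2, 11)`, over the field `ZMod 11`, by its center. -/
abbrev PSL211 : Type :=
  Matrix.ProjectiveSpecialLinearGroup (Fin 2) (ZMod 11)

/-! Write `α_q` for the exponent of `q` in `ρ(G)`, that is, the sum over `g` of the `q`-adic
valuation of `o(g)`. For a prime `p ≠ q` this valuation depends only on the `p'`-part of `g`. The
fibre of `g ↦ p'`-part over `s` is in bijection with the `p`-elements of the centralizer of `s`,
whose number is divisible by the `p`-part of the centralizer's order (Frobenius). Summing over
conjugacy classes, the `q'`-part of `|G|` divides `α_q`. For the four given exponents, greatest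
common divisors then match each exponent to its prime and leave `|G| = 330` or `660`.

If `p` divides `|G|` exactly once, `α_p` counts the elements of order divisible by `p`, and `p α_p =
n_p (p - 1) |C(P)|` for a Sylow subgroup `P`. From `α_11 = 120` and `α_5 = 264` this yields `|G| =
660` and twelve self-centralizing Sylow 11-subgroups. Label these by the projective line over the
field of 11 elements so that the stabilizer of `∞` consists of the maps `x ↦ 3 ^ j x + i`. An
element `t` swapping `0` and `∞` cannot commute with `h : x ↦ 3 x`, again because of `α_5`, so it is
an involution inverting `h`. It is then determined by its values at `1` and `-1`, and a finite check
leaves only `x ↦ -1 / x` up to powers of `h`.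

Thus every group with these exponents is isomorphic to one fixed permutation group. A trace
computation shows that `PSL(2, 11)` has these exponents, so it is isomorphic to that group too. -/

open scoped Pointwise

/-! ### Counting elements by their `p'`-part; Frobenius' theorem -/

theorem ConjClasses.natCard_carrier_mul_natCard_centralizer {G : Type*} [Group G] [Finite G]
    (g : G) : Nat.card (ConjClasses.mk g).carrier * Nat.card (Subgroup.centralizer {g}) =
      Nat.card G := by
  rw [← ConjAct.orbit_eq_carrier_conjClasses]
  have h1 := Subgroup.card_mul_index (MulAction.stabilizer (ConjAct G) g)
  rw [MulAction.index_stabilizer, ConjAct.stabilizer_eq_centralizer] at h1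
  rw [mul_comm]
  exact h1

/-- The class of `g` contributes `|G| / |C(g)| * w g` to the sum, and `hd` makes each such term
divisible by `d`. -/
theorem dvd_sum_of_conj_invariant {G : Type*} [Group G] [Fintype G] (w : G → ℕ)
    (hw : ∀ g h, w (h * g * h⁻¹) = w g) (d : ℕ)
    (hd : ∀ g, d * Nat.card (Subgroup.centralizer {g}) ∣ Nat.card G * w g) :
    d ∣ ∑ g, w g := by
  classical
  have : Fintype (ConjClasses G) := Fintype.ofFinite _
  rw [← Finset.sum_fiberwise Finset.univ (ConjClasses.mk : G → ConjClasses G)]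
  refine Finset.dvd_sum fun c _ => ?_
  obtain ⟨g, rfl⟩ := ConjClasses.exists_rep c
  have hconst : ∀ x ∈ Finset.univ.filter (fun x => ConjClasses.mk x = ConjClasses.mk g),
      w x = w g := by
    intro x hx
    rw [Finset.mem_filter, ConjClasses.mk_eq_mk_iff_isConj, isConj_comm, isConj_iff] at hx
    obtain ⟨c, rfl⟩ := hx.2
    exact hw g c
  rw [Finset.sum_congr rfl hconst, Finset.sum_const, smul_eq_mul]
  have hcard : (Finset.univ.filter (fun x => ConjClasses.mk x = ConjClasses.mk g)).card =
      Nat.card (ConjClasses.mk g).carrier := by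
    rw [← Fintype.card_subtype, ← Nat.card_eq_fintype_card]
    exact Nat.card_congr (Equiv.subtypeEquivRight fun x => ConjClasses.mem_carrier_iff_mk_eq.symm)
  rw [hcard]
  have h := hd g
  rw [← ConjClasses.natCard_carrier_mul_natCard_centralizer g] at h
  have hpos : 0 < Nat.card (Subgroup.centralizer {g}) := Nat.card_pos
  exact Nat.dvd_of_mul_dvd_mul_right hpos (by convert h using 1; ring)

/-- Since `e` is `0` modulo `a` and `1` modulo `b`, the power `g ^ e` is the `b`-part of `g`. It
commutes with `g`, and dividing it out leaves the `a`-part, an arbitrary element of the centralizer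
killed by `a`. -/
theorem natCard_pow_fiber_eq {G : Type*} [Group G] {a b e : ℕ} (hG : ∀ g : G, g ^ (a * b) = 1)
    (hae : a ∣ e) (hbe : e ≡ 1 [MOD b]) {s : G} (hs : s ^ b = 1) :
    Nat.card {g : G // g ^ e = s} =
      Nat.card {v : Subgroup.centralizer {s} // v ^ a = 1} := by
  have hse : s ^ e = s := by
    have := pow_eq_pow_iff_modEq.2 (hbe.of_dvd (orderOf_dvd_of_pow_eq_one hs))
    simpa using this
  have hga : ∀ g : G, (g ^ e) ^ a = g ^ a := by
    intro g
    rw [← pow_mul]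
    refine pow_eq_pow_iff_modEq.2 (Nat.ModEq.of_dvd (orderOf_dvd_of_pow_eq_one (hG g)) ?_)
    have := hbe.mul_left' a
    rwa [mul_one, mul_comm a e] at this
  refine Nat.card_congr
    { toFun := fun g => ⟨⟨g.1 * s⁻¹, ?_⟩, ?_⟩
      invFun := fun v => ⟨v.1.1 * s, ?_⟩
      left_inv := fun g => by simp
      right_inv := fun v => by simp }
  · obtain ⟨g, rfl⟩ := g
    rw [Subgroup.mem_centralizer_singleton_iff]
    group
  · obtain ⟨g, rfl⟩ := g
    apply Subtype.ext
    have hc : Commute g (g ^ e)⁻¹ := (Commute.self_pow g e).inv_right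
    simp only [SubmonoidClass.mk_pow, OneMemClass.coe_one]
    rw [hc.mul_pow, inv_pow, hga, mul_inv_cancel]
  · obtain ⟨⟨v, hv⟩, hv1⟩ := v
    have hc : Commute v s := by
      rw [Subgroup.mem_centralizer_singleton_iff] at hv
      exact hv
    have hv2 : v ^ a = 1 := by simpa using congrArg Subtype.val hv1
    obtain ⟨k, rfl⟩ := hae
    rw [hc.mul_pow, hse, pow_mul, hv2, one_pow, one_mul]

theorem natCard_pow_fiber_conj {G : Type*} [Group G] (e : ℕ) (s h : G) :
    Nat.card {g : G // g ^ e = h * s * h⁻¹} = Nat.card {g : G // g ^ e = s} := by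
  refine Nat.card_congr ((MulAut.conj h).toEquiv.subtypeEquiv fun g => ?_).symm
  simp [conj_pow]

theorem exists_dvd_modEq_one {a b : ℕ} (h : a.Coprime b) : ∃ e, a ∣ e ∧ e ≡ 1 [MOD b] := by
  obtain ⟨e, he⟩ := Nat.chineseRemainder h 0 1
  exact ⟨e, (Nat.modEq_zero_iff_dvd).1 he.1, he.2⟩

theorem sum_comp_pow_eq {G : Type*} [Group G] [Fintype G] (φ : G → ℕ) (e : ℕ) :
    ∑ g, φ (g ^ e) = ∑ s : G, φ s * Nat.card {g : G // g ^ e = s} := by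
  classical
  rw [← Finset.sum_fiberwise Finset.univ (fun g : G => g ^ e)]
  refine Finset.sum_congr rfl fun s _ => ?_
  have : ∀ g ∈ Finset.univ.filter (fun g : G => g ^ e = s), φ (g ^ e) = φ s := by
    intro g hg
    rw [(Finset.mem_filter.1 hg).2]
  rw [Finset.sum_congr rfl this, Finset.sum_const, smul_eq_mul, mul_comm,
    Nat.card_eq_fintype_card, Fintype.card_subtype]

theorem natCard_pow_fiber_eq_zero {G : Type*} [Group G] {a b e : ℕ}
    (hG : ∀ g : G, g ^ (a * b) = 1) (hae : a ∣ e) {s : G} (hs : s ^ b ≠ 1) :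
    Nat.card {g : G // g ^ e = s} = 0 := by
  have : IsEmpty {g : G // g ^ e = s} := by
    refine ⟨fun ⟨g, hg⟩ => hs ?_⟩
    obtain ⟨k, rfl⟩ := hae
    rw [← hg, ← pow_mul, mul_assoc, mul_comm k, ← mul_assoc, pow_mul, hG, one_pow]
  exact Nat.card_of_isEmpty

theorem ordProj_natCard_subgroup_dvd {G : Type*} [Group G] [Finite G] {p : ℕ}
    (H : Subgroup G) : ordProj[p] (Nat.card H) ∣ ordProj[p] (Nat.card G) :=
  Nat.ordProj_dvd_ordProj_of_dvd Nat.card_pos.ne' (Subgroup.card_subgroup_dvd_card H) p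

/-- With `c` the order of a centralizer in a group of order `n`, this turns a divisibility by the
`p`-part of `c` into the hypothesis of `dvd_sum_of_conj_invariant`. -/
theorem ordProj_mul_dvd_mul {n c N p : ℕ} (hc : c ∣ n) (hN : ordProj[p] c ∣ N) :
    ordProj[p] n * c ∣ n * N := by
  have h := mul_dvd_mul hN (Nat.ordCompl_dvd_ordCompl_of_dvd hc p)
  rw [Nat.ordProj_mul_ordCompl_eq_self] at h
  calc ordProj[p] n * c ∣ ordProj[p] n * (N * ordCompl[p] n) := mul_dvd_mul_left _ h
    _ = (ordProj[p] n * ordCompl[p] n) * N := by ring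
    _ = n * N := by rw [Nat.ordProj_mul_ordCompl_eq_self]

/-- The subgroup of the central elements whose `b`-th power is trivial. -/
def centralPowKer (G : Type*) [Group G] (b : ℕ) : Subgroup G where
  carrier := {s | s ∈ Subgroup.center G ∧ s ^ b = 1}
  one_mem' := ⟨Subgroup.one_mem _, one_pow b⟩
  mul_mem' := fun {x y} hx hy => ⟨Subgroup.mul_mem _ hx.1 hy.1, by
    have : Commute x y := (Subgroup.mem_center_iff.1 hy.1 x)
    rw [this.mul_pow, hx.2, hy.2, one_mul]⟩
  inv_mem' := fun hx => ⟨Subgroup.inv_mem _ hx.1, by rw [inv_pow, hx.2, inv_one]⟩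

/-- The number of `p`-elements of a finite group is divisible by the `p`-part of its order. -/
theorem ordProj_dvd_natCard_pow_eq_one {p : ℕ} (hp : p.Prime) (G : Type*) [Group G] [Finite G]
    {k : ℕ} (hk : ordProj[p] (Nat.card G) ∣ p ^ k) :
    ordProj[p] (Nat.card G) ∣ Nat.card {v : G // v ^ p ^ k = 1} := by
  classical
  -- The exponent `k` is only required to be large enough, so the same `k` serves for all
  -- centralizers in the induction.
  induction hn : Nat.card G using Nat.strong_induction_on generalizing G with
  | _ n ih =>
  subst hn
  have : Fintype G := Fintype.ofFinite G
  set b := ordCompl[p] (Nat.card G) with hb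
  have hn0 : Nat.card G ≠ 0 := Nat.card_pos.ne'
  have hcop : Nat.Coprime (p ^ k) b := (Nat.coprime_ordCompl hp hn0).pow_left k
  obtain ⟨e, hae, hbe⟩ := exists_dvd_modEq_one hcop
  have hG : ∀ g : G, g ^ (p ^ k * b) = 1 := by
    intro g
    refine orderOf_dvd_iff_pow_eq_one.1 ((orderOf_dvd_natCard g).trans ?_)
    conv_lhs => rw [← Nat.ordProj_mul_ordCompl_eq_self (Nat.card G) p]
    exact mul_dvd_mul_right hk b
  have hcent : ∀ s : G, s ∈ Subgroup.center G → Subgroup.centralizer {s} = ⊤ := by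
    intro s hs
    rw [Subgroup.centralizer_eq_top_iff_subset]
    simpa using hs
  set w : G → ℕ := fun s => Nat.card {g : G // g ^ e = s} with hw
  have hsum : ∑ s, w s = Nat.card G := by
    have := sum_comp_pow_eq (fun _ : G => 1) e
    simp only [Finset.sum_const, one_mul, Finset.card_univ, smul_eq_mul, mul_one] at this
    rw [← this, Nat.card_eq_fintype_card]
  have hsplit : ∑ s, w s = ∑ s, (if s ∈ Subgroup.center G then w s else 0) +
      ∑ s, (if s ∈ Subgroup.center G then 0 else w s) := by
    rw [← Finset.sum_add_distrib]
    refine Finset.sum_congr rfl fun s _ => ?_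
    split_ifs <;> simp
  -- Non-central `s` have proper centralizers, to which the induction hypothesis applies.
  have hnon : ordProj[p] (Nat.card G) ∣ ∑ s, (if s ∈ Subgroup.center G then 0 else w s) := by
    refine dvd_sum_of_conj_invariant _ (fun g h => ?_) _ fun s => ?_
    · have : h * g * h⁻¹ ∈ Subgroup.center G ↔ g ∈ Subgroup.center G :=
        ⟨fun hh => by simpa [mul_assoc] using
          (Subgroup.Normal.conj_mem inferInstance _ hh h⁻¹ : _ ∈ Subgroup.center G),
          fun hh => Subgroup.Normal.conj_mem inferInstance _ hh h⟩
      simp only [this, hw, natCard_pow_fiber_conj]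
    · split_ifs with hs
      · simp
      · by_cases hsb : s ^ b = 1
        · have hlt : Nat.card (Subgroup.centralizer {s}) < Nat.card G := by
            refine lt_of_le_of_ne (Subgroup.card_le_card_group _) fun h => hs ?_
            have := Subgroup.eq_top_of_card_eq _ h
            rw [Subgroup.centralizer_eq_top_iff_subset] at this
            simpa using this
          have h1 := ih _ hlt (Subgroup.centralizer {s})
            ((ordProj_natCard_subgroup_dvd _).trans hk) rfl
          simp only [hw]
          rw [natCard_pow_fiber_eq hG hae hbe hsb]
          exact ordProj_mul_dvd_mul (Subgroup.card_subgroup_dvd_card _) h1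
        · simp only [hw]
          rw [natCard_pow_fiber_eq_zero hG hae hsb]
          simp
  -- Over each central `p'`-element the fibre is as large as the set of `p`-elements of `G`, the
  -- number sought.
  have hz : ∑ s, (if s ∈ Subgroup.center G then w s else 0) =
      Nat.card (centralPowKer G b) *
        Nat.card {v : G // v ^ p ^ k = 1} := by
    have h1 : ∀ s : G, (if s ∈ Subgroup.center G then w s else 0) =
        if s ∈ Subgroup.center G ∧ s ^ b = 1 then Nat.card {v : G // v ^ p ^ k = 1} else 0 := by
      intro s
      by_cases hs : s ∈ Subgroup.center G
      · by_cases hsb : s ^ b = 1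
        · simp only [hs, hsb, and_self, if_true, hw]
          rw [natCard_pow_fiber_eq hG hae hbe hsb, hcent s hs]
          refine Nat.card_congr (Subgroup.topEquiv.toEquiv.subtypeEquiv fun v => ?_)
          rw [Subtype.ext_iff]
          simp
        · simp only [hs, hsb, and_false, if_true, if_false, hw]
          exact natCard_pow_fiber_eq_zero hG hae hsb
      · simp [hs]
    rw [Finset.sum_congr rfl fun s _ => h1 s, ← Finset.sum_filter, Finset.sum_const, smul_eq_mul]
    congr 1
    rw [← Fintype.card_subtype, ← Nat.card_eq_fintype_card]
    rfl
  -- By Cauchy, the number of central `p'`-elements is prime to `p`, so it can be cancelled.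
  have hzcop : Nat.Coprime (ordProj[p] (Nat.card G))
      (Nat.card (centralPowKer G b)) := by
    refine Nat.Coprime.pow_left _ ((Nat.Prime.coprime_iff_not_dvd hp).2 fun hdvd => ?_)
    have : Fact p.Prime := ⟨hp⟩
    obtain ⟨x, hx⟩ := exists_prime_orderOf_dvd_card' p hdvd
    have hxb : x ^ b = 1 := Subtype.ext x.2.2
    have := orderOf_dvd_of_pow_eq_one hxb
    rw [hx] at this
    exact Nat.not_dvd_ordCompl hp hn0 this
  rw [hsum, hz] at hsplit
  refine hzcop.dvd_of_dvd_mul_left ((Nat.dvd_add_left hnon).1 ?_)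
  rw [← hsplit]
  exact Nat.ordProj_dvd _ _

/-- The sum of a class function that depends only on the `p'`-part of its argument is divisible
by the `p`-part of the group order. -/
theorem ordProj_dvd_sum_comp_pow {p : ℕ} (hp : p.Prime) {G : Type*} [Group G] [Fintype G] {e : ℕ}
    (hae : ordProj[p] (Nat.card G) ∣ e) (hbe : e ≡ 1 [MOD ordCompl[p] (Nat.card G)])
    (φ : G → ℕ) (hφ : ∀ g h, φ (h * g * h⁻¹) = φ g) :
    ordProj[p] (Nat.card G) ∣ ∑ g, φ (g ^ e) := by
  have hG : ∀ g : G, g ^ (ordProj[p] (Nat.card G) * ordCompl[p] (Nat.card G)) = 1 := by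
    intro g
    rw [Nat.ordProj_mul_ordCompl_eq_self]
    exact pow_card_eq_one'
  rw [sum_comp_pow_eq]
  refine dvd_sum_of_conj_invariant _ (fun g h => by rw [hφ, natCard_pow_fiber_conj]) _ fun s => ?_
  by_cases hsb : s ^ (ordCompl[p] (Nat.card G)) = 1
  · rw [natCard_pow_fiber_eq hG hae hbe hsb]
    have h1 := ordProj_dvd_natCard_pow_eq_one hp (Subgroup.centralizer {s})
      (ordProj_natCard_subgroup_dvd _)
    exact ordProj_mul_dvd_mul (Subgroup.card_subgroup_dvd_card _) (h1.mul_left _)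
  · rw [natCard_pow_fiber_eq_zero hG hae hsb]
    simp

/-! ### The exponents of `ρ(G)` and the order of `G` -/

theorem prodElementOrders_eq_prod (G : Type*) [Group G] [Fintype G] :
    prodElementOrders G = ∏ g : G, orderOf g := finprod_eq_prod_of_fintype _

theorem prodElementOrders_congr {G H : Type*} [Group G] [Finite G] [Group H] [Finite H]
    (e : G ≃* H) : prodElementOrders G = prodElementOrders H :=
  finprod_eq_of_bijective e e.bijective fun g => (orderOf_injective e.toMonoidHom e.injective g).symm

theorem factorization_prodElementOrders (G : Type*) [Group G] [Fintype G] (p : ℕ) :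
    (prodElementOrders G).factorization p = ∑ g : G, (orderOf g).factorization p := by
  rw [prodElementOrders_eq_prod, Nat.factorization_prod fun g _ => (orderOf_pos g).ne']
  simp

theorem mem_primeFactors_prodElementOrders {G : Type*} [Group G] [Finite G] {p : ℕ} :
    p ∈ (prodElementOrders G).primeFactors ↔ p.Prime ∧ p ∣ Nat.card G := by
  have : Fintype G := Fintype.ofFinite G
  have h0 : prodElementOrders G ≠ 0 := by
    rw [prodElementOrders_eq_prod]
    exact Finset.prod_ne_zero_iff.2 fun g _ => (orderOf_pos g).ne'
  rw [Nat.mem_primeFactors_of_ne_zero h0]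
  refine and_congr_right fun hp => ⟨fun h => ?_, fun h => ?_⟩
  · rw [prodElementOrders_eq_prod, hp.prime.dvd_finsetProd_iff] at h
    obtain ⟨g, -, hg⟩ := h
    exact hg.trans (orderOf_dvd_natCard g)
  · rw [prodElementOrders_eq_prod]
    exact h.trans (Group.card_dvd_prod_orderOf G)

theorem factorization_orderOf_conj {G : Type*} [Group G] (p : ℕ) (g h : G) :
    (orderOf (h * g * h⁻¹)).factorization p = (orderOf g).factorization p := by
  rw [show h * g * h⁻¹ = MulAut.conj h g from rfl,
    show orderOf (MulAut.conj h g) = orderOf g from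
      orderOf_injective (MulAut.conj h).toMonoidHom (MulAut.conj h).injective g]

/-- The `p'`-part of the order of `G` divides the exponent of `p` in the product of the element
orders. -/
theorem ordCompl_dvd_factorization_prodElementOrders {G : Type*} [Group G] [Finite G] {q : ℕ}
    (hq : q.Prime) :
    ordCompl[q] (Nat.card G) ∣ (prodElementOrders G).factorization q := by
  have : Fintype G := Fintype.ofFinite G
  have hn0 : Nat.card G ≠ 0 := Nat.card_pos.ne'
  by_cases hα : (prodElementOrders G).factorization q = 0
  · simp [hα]
  rw [← Nat.factorization_le_iff_dvd (Nat.ordCompl_pos q hn0).ne' hα, Nat.factorization_ordCompl]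
  intro p
  by_cases hpq : p = q
  · simp [hpq]
  rw [Finsupp.erase_ne hpq]
  by_cases hp : p.Prime
  swap
  · simp [Nat.factorization_eq_zero_of_not_prime _ hp]
  rw [← hp.pow_dvd_iff_le_factorization hα, factorization_prodElementOrders]
  obtain ⟨e, hae, hbe⟩ := exists_dvd_modEq_one
    ((Nat.coprime_ordCompl hp hn0).pow_left ((Nat.card G).factorization p))
  have hmain := ordProj_dvd_sum_comp_pow hp hae hbe (fun g : G => (orderOf g).factorization q)
    fun g h => factorization_orderOf_conj q g h
  -- Passing to the `p'`-part `g ^ e` keeps the exponent of `q` in the order: if `q` divides `o(g)`,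
  -- then `e ≡ 1` modulo `q`.
  convert hmain using 1
  refine Finset.sum_congr rfl fun g _ => ?_
  rw [orderOf_pow]
  by_cases hqg : q ∣ orderOf g
  · have hqn : q ∣ ordCompl[p] (Nat.card G) :=
      Nat.dvd_ordCompl_of_dvd_not_dvd (hqg.trans (orderOf_dvd_natCard g))
        fun h => hpq ((Nat.prime_dvd_prime_iff_eq hp hq).1 h)
    have hqe : ¬ q ∣ e := fun h => by
      have h1 := (hbe.of_dvd hqn)
      have h2 : 0 ≡ 1 [MOD q] := ((Nat.modEq_zero_iff_dvd.2 h).symm.trans h1)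
      exact hq.one_lt.ne' (Nat.dvd_one.1 ((Nat.modEq_zero_iff_dvd).1 h2.symm))
    rw [Nat.factorization_div (Nat.gcd_dvd_left _ _), Finsupp.tsub_apply,
      Nat.factorization_eq_zero_of_not_dvd fun h => hqe (h.trans (Nat.gcd_dvd_right _ _)),
      Nat.sub_zero]
  · rw [Nat.factorization_eq_zero_of_not_dvd hqg, Nat.factorization_eq_zero_of_not_dvd]
    exact fun h => hqg (h.trans (Nat.div_dvd_of_dvd (Nat.gcd_dvd_left _ _)))

theorem Nat.dvd_ordCompl_of_prime_ne {n r q : ℕ} (hr : r.Prime) (hq : q.Prime)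
    (h : r ≠ q) (hn : r ∣ n) : r ∣ ordCompl[q] n :=
  Nat.dvd_ordCompl_of_dvd_not_dvd hn fun h' => h ((Nat.prime_dvd_prime_iff_eq hq hr).1 h').symm

theorem Nat.Prime.eq_of_dvd_gcd {q r x y : ℕ} (hq : q.Prime) (hr : r.Prime)
    (hxy : ∃ k, x.gcd y ∣ r ^ k) (hx : q ∣ x) (hy : q ∣ y) : q = r := by
  obtain ⟨k, hk⟩ := hxy
  exact (Nat.prime_dvd_prime_iff_eq hq hr).1 (hq.dvd_of_dvd_pow ((Nat.dvd_gcd hx hy).trans hk))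

/-- Each of the four primes divides the three exponents belonging to the others. The gcds of these
triples are `11`, `4`, `3`, `5`, omitting `120`, `165`, `220`, `264` respectively, and each is a
power of a single prime. -/
theorem natCard_and_factorization_of_expRho_eq {G : Type*} [Group G] [Finite G]
    (h : expRho G = {120, 165, 220, 264}) :
    (Nat.card G = 330 ∨ Nat.card G = 660) ∧
      (prodElementOrders G).factorization 11 = 120 ∧
      (prodElementOrders G).factorization 5 = 264 := by
  have hex : ∀ α ∈ ({120, 165, 220, 264} : Finset ℕ), ∃ q, q.Prime ∧ q ∣ Nat.card G ∧
      (prodElementOrders G).factorization q = α ∧ ordCompl[q] (Nat.card G) ∣ α := by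
    intro α hα
    rw [← h, expRho, primeExponents, Finset.mem_image] at hα
    obtain ⟨q, hq, rfl⟩ := hα
    rw [mem_primeFactors_prodElementOrders] at hq
    exact ⟨q, hq.1, hq.2, rfl, ordCompl_dvd_factorization_prodElementOrders hq.1⟩
  obtain ⟨q₁, hp₁, hd₁, hα₁, ho₁⟩ := hex 120 (by simp)
  obtain ⟨q₂, hp₂, hd₂, hα₂, ho₂⟩ := hex 165 (by simp)
  obtain ⟨q₃, hp₃, hd₃, hα₃, ho₃⟩ := hex 220 (by simp)
  obtain ⟨q₄, hp₄, hd₄, hα₄, ho₄⟩ := hex 264 (by simp)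
  have h12 : q₁ ≠ q₂ := by rintro rfl; omega
  have h13 : q₁ ≠ q₃ := by rintro rfl; omega
  have h14 : q₁ ≠ q₄ := by rintro rfl; omega
  have h23 : q₂ ≠ q₃ := by rintro rfl; omega
  have h24 : q₂ ≠ q₄ := by rintro rfl; omega
  have h34 : q₃ ≠ q₄ := by rintro rfl; omega
  have key : ∀ {r q α : ℕ}, r.Prime → q.Prime → r ≠ q → r ∣ Nat.card G →
      ordCompl[q] (Nat.card G) ∣ α → r ∣ α :=
    fun hr hq hrq hd ho => (Nat.dvd_ordCompl_of_prime_ne hr hq hrq hd).trans ho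
  obtain rfl : q₂ = 2 := hp₂.eq_of_dvd_gcd Nat.prime_two ⟨2, by norm_num⟩
    (key hp₂ hp₃ h23 hd₂ ho₃) (Nat.dvd_gcd (key hp₂ hp₁ h12.symm hd₂ ho₁)
      (key hp₂ hp₄ h24 hd₂ ho₄))
  obtain rfl : q₁ = 11 := hp₁.eq_of_dvd_gcd (by norm_num) ⟨1, by norm_num⟩
    (key hp₁ hp₂ h12 hd₁ ho₂) (key hp₁ hp₃ h13 hd₁ ho₃ |> fun h3 =>
      Nat.dvd_gcd h3 (key hp₁ hp₄ h14 hd₁ ho₄))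
  obtain rfl : q₃ = 3 := hp₃.eq_of_dvd_gcd (by norm_num) ⟨1, by norm_num⟩
    (key hp₃ hp₁ h13.symm hd₃ ho₁) (key hp₃ hp₂ h23.symm hd₃ ho₂ |> fun h3 =>
      Nat.dvd_gcd h3 (key hp₃ hp₄ h34 hd₃ ho₄))
  obtain rfl : q₄ = 5 := hp₄.eq_of_dvd_gcd (by norm_num) ⟨1, by norm_num⟩
    (key hp₄ hp₁ h14.symm hd₄ ho₁) (key hp₄ hp₂ h24.symm hd₄ ho₂ |> fun h3 =>
      Nat.dvd_gcd h3 (key hp₄ hp₃ h34.symm hd₄ ho₃))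
  refine ⟨?_, hα₁, hα₄⟩
  have hn0 : Nat.card G ≠ 0 := Nat.card_pos.ne'
  -- The `2`-part of `|G|` divides `α_3 = 220 = 4 * 55`; the odd part divides `α_2 = 165`.
  have htwo : ordProj[2] (Nat.card G) ∣ 4 := by
    have h1 : ordProj[2] (Nat.card G) ∣ ordCompl[3] (Nat.card G) :=
      Nat.dvd_ordCompl_of_dvd_not_dvd (Nat.ordProj_dvd _ _) fun h =>
        absurd (Nat.prime_three.dvd_of_dvd_pow h) (by norm_num)
    have h2 : ordProj[2] (Nat.card G) ∣ 4 * 55 := h1.trans ho₃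
    exact Nat.Coprime.dvd_of_dvd_mul_right (Nat.Coprime.pow_left _ (by norm_num)) h2
  have h660 : Nat.card G ∣ 660 := by
    rw [← Nat.ordProj_mul_ordCompl_eq_self (Nat.card G) 2]
    exact mul_dvd_mul htwo ho₂
  have h330 : 330 ∣ Nat.card G := by
    have h6 := Nat.Coprime.mul_dvd_of_dvd_of_dvd (by norm_num) hd₂ hd₃
    have h55 := Nat.Coprime.mul_dvd_of_dvd_of_dvd (by norm_num) hd₁ hd₄
    exact Nat.Coprime.mul_dvd_of_dvd_of_dvd (m := 6) (n := 55) (by norm_num) h6 (by simpa using h55)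
  obtain ⟨k, hk⟩ := h330
  obtain ⟨l, hl⟩ := h660
  rw [hk] at hl ⊢
  have hk2 : k * l = 2 := by nlinarith
  have : k ≤ 2 := Nat.le_of_dvd (by norm_num) ⟨l, hk2.symm⟩
  interval_cases k <;> omega

/-! ### Sylow subgroups of prime order -/

theorem Sylow.zpowers_eq_of_mem {p : ℕ} [hp : Fact p.Prime] {G : Type*} [Group G]
    (P : Sylow p G) (hP : Nat.card P = p) {u : G} (hu : u ∈ P) (hu1 : u ≠ 1) :
    Subgroup.zpowers u = (P : Subgroup G) := by
  have hfin : Finite (P : Subgroup G) :=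
    Nat.finite_of_card_ne_zero (by rw [hP]; exact hp.out.ne_zero)
  refine Subgroup.eq_of_le_of_card_ge (Subgroup.zpowers_le.2 hu) ?_
  have h1 : u ^ p = 1 := by
    have := pow_card_eq_one' (G := P) (x := ⟨u, hu⟩)
    rw [hP] at this
    exact congrArg Subtype.val this
  rw [hP, Nat.card_zpowers, orderOf_eq_prime h1 hu1]

/-- A `p`-subgroup meets the normalizer of `P` inside `P`. -/
theorem Sylow.mem_of_pow_eq_one_of_mem_centralizer {p : ℕ} [hp : Fact p.Prime] {G : Type*}
    [Group G] [Finite G] (P : Sylow p G) {s : G} (hs : s ^ p = 1)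
    (hc : s ∈ Subgroup.centralizer (P : Set G)) : s ∈ P := by
  have hpg : IsPGroup p (Subgroup.zpowers s) := by
    by_cases h1 : s = 1
    · subst h1
      rw [Subgroup.zpowers_one_eq_bot]
      exact IsPGroup.of_bot
    · exact IsPGroup.of_card (n := 1) (by rw [Nat.card_zpowers, orderOf_eq_prime hs h1, pow_one])
  have h := hpg.inf_normalizer_sylow P
  have hmem : s ∈ Subgroup.zpowers s ⊓ Subgroup.normalizer (P : Set G) :=
    ⟨Subgroup.mem_zpowers s, Subgroup.centralizer_le_normalizer _ hc⟩
  exact ((h ▸ hmem : s ∈ Subgroup.zpowers s ⊓ (P : Subgroup G))).2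

theorem Sylow.natCard_centralizer_smul {p : ℕ} {G : Type*} [Group G] (P : Sylow p G) (g : G) :
    Nat.card (Subgroup.centralizer ((g • P : Sylow p G) : Set G)) =
      Nat.card (Subgroup.centralizer (P : Set G)) := by
  refine Nat.card_congr ((MulAut.conj g).toEquiv.subtypeEquiv fun c => ?_).symm
  simp only [MulEquiv.toEquiv_eq_coe, EquivLike.coe_coe, Subgroup.mem_centralizer_iff,
    Sylow.coe_smul]
  constructor
  · rintro h _ ⟨x, hx, rfl⟩
    have := congrArg (MulAut.conj g) (h x hx)
    simpa using this
  · intro h x hx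
    have := h (MulAut.conj g x) ⟨x, hx, rfl⟩
    rw [← map_mul, ← map_mul] at this
    exact (MulAut.conj g).injective this

/-- Here `g ^ f` is the `p`-part of `g`. Elements with `p`-part `u` centralize `P`, which `u`
generates, and multiplying them by elements of `P` shifts the `p`-part over all of `P`. Hence `(x,
g) ↦ g * x` is a bijection from `P` times the fibre onto the centralizer. -/
theorem Sylow.mul_natCard_pow_fiber {p : ℕ} [hp : Fact p.Prime] {G : Type*} [Group G] [Finite G]
    (P : Sylow p G) (hP : Nat.card P = p) {m f : ℕ} (hG : ∀ g : G, g ^ (m * p) = 1)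
    (hmf : m ∣ f) (hpf : f ≡ 1 [MOD p]) {u : G} (hu : u ∈ P) (hu1 : u ≠ 1) :
    p * Nat.card {g : G // g ^ f = u} = Nat.card (Subgroup.centralizer (P : Set G)) := by
  have hxp : ∀ x ∈ P, x ^ p = 1 := by
    intro x hx
    have := pow_card_eq_one' (G := P) (x := ⟨x, hx⟩)
    rw [hP] at this
    exact congrArg Subtype.val this
  have hxf : ∀ x ∈ P, x ^ f = x := by
    intro x hx
    simpa using pow_eq_pow_iff_modEq.2 (hpf.of_dvd (orderOf_dvd_of_pow_eq_one (hxp x hx)))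
  have hgf : ∀ g : G, (g ^ f) ^ p = 1 := by
    intro g
    obtain ⟨k, rfl⟩ := hmf
    rw [← pow_mul, mul_assoc, mul_comm k, ← mul_assoc, pow_mul, hG, one_pow]
  have hcP : ∀ c ∈ Subgroup.centralizer (P : Set G), c ^ f ∈ P := fun c hc =>
    P.mem_of_pow_eq_one_of_mem_centralizer (hgf c) (Subgroup.pow_mem _ hc f)
  have hcomm : ∀ c ∈ Subgroup.centralizer (P : Set G), ∀ x ∈ P, Commute c x := fun c hc x hx =>
    (Subgroup.mem_centralizer_iff.1 hc x hx).symm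
  have hPC : ∀ x ∈ P, x ∈ Subgroup.centralizer (P : Set G) := by
    intro x hx
    rw [Subgroup.mem_centralizer_iff]
    intro y hy
    have hzu := P.zpowers_eq_of_mem hP hu hu1
    have hx' : x ∈ Subgroup.zpowers u := hzu ▸ hx
    have hy' : y ∈ Subgroup.zpowers u := hzu ▸ hy
    obtain ⟨i, rfl⟩ := Subgroup.mem_zpowers_iff.1 hx'
    obtain ⟨j, rfl⟩ := Subgroup.mem_zpowers_iff.1 hy'
    exact (Commute.refl u).zpow_zpow j i
  have hfc : ∀ g : G, g ^ f = u → g ∈ Subgroup.centralizer (P : Set G) := by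
    rintro g hg
    rw [Subgroup.mem_centralizer_iff]
    intro y hy
    have hy' : y ∈ Subgroup.zpowers u := P.zpowers_eq_of_mem hP hu hu1 ▸ hy
    obtain ⟨j, rfl⟩ := Subgroup.mem_zpowers_iff.1 hy'
    rw [← hg]
    exact ((Commute.refl g).pow_left f).zpow_left j
  conv_lhs => enter [1]; rw [← hP]
  rw [← Nat.card_prod]
  refine Nat.card_congr
    { toFun := fun y => ⟨y.2.1 * y.1, ?_⟩
      invFun := fun c => ⟨⟨c.1 ^ f * u⁻¹, ?_⟩, ⟨c.1 * (c.1 ^ f)⁻¹ * u, ?_⟩⟩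
      left_inv := ?_
      right_inv := ?_ }
  · exact Subgroup.mul_mem _ (hfc _ y.2.2) (hPC _ y.1.2)
  · exact P.mul_mem (hcP _ c.2) (P.inv_mem hu)
  · have hc := c.2
    have h1 : Commute c.1 (c.1 ^ f)⁻¹ := (Commute.self_pow c.1 f).inv_right
    have h2 : Commute (c.1 * (c.1 ^ f)⁻¹) u :=
      hcomm _ (Subgroup.mul_mem _ hc (Subgroup.inv_mem _ (Subgroup.pow_mem _ hc f))) u hu
    rw [h2.mul_pow, h1.mul_pow, inv_pow, hxf _ (hcP _ hc), mul_inv_cancel, one_mul, hxf u hu]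
  · rintro ⟨⟨x, hx⟩, ⟨g, hg⟩⟩
    have h1 : (g * x) ^ f = u * x := by
      rw [(hcomm g (hfc g hg) x hx).mul_pow, hg, hxf x hx]
    have h2 : u * x = x * u := hcomm u (hPC u hu) x hx
    simp only [h1, Prod.mk.injEq, Subtype.mk.injEq]
    constructor
    · rw [h2, mul_inv_cancel_right]
    · group
  · rintro ⟨c, hc⟩
    have h1 : c ^ f * u⁻¹ = u⁻¹ * c ^ f := hcomm _ (Subgroup.pow_mem _ hc f) _ (P.inv_mem hu)
    simp only [Subtype.mk.injEq]
    rw [h1]; group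

/-- There are `n_p (p - 1)` nontrivial possible `p`-parts, and each is the `p`-part of `|C(P)| / p`
elements. -/
theorem Sylow.prime_mul_factorization_prodElementOrders {p : ℕ} [hp : Fact p.Prime] {G : Type*}
    [Group G] [Finite G] (hpG : (Nat.card G).factorization p = 1) (P : Sylow p G) :
    p * (prodElementOrders G).factorization p =
      Nat.card (Sylow p G) * ((p - 1) * Nat.card (Subgroup.centralizer (P : Set G))) := by
  classical
  have : Fintype G := Fintype.ofFinite G
  have : Fintype (Sylow p G) := Fintype.ofFinite _
  have hn0 : Nat.card G ≠ 0 := Nat.card_pos.ne'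
  set m := ordCompl[p] (Nat.card G) with hm
  have hnm : m * p = Nat.card G := by
    have := Nat.ordProj_mul_ordCompl_eq_self (Nat.card G) p
    rw [hpG, pow_one] at this
    rw [mul_comm, hm, hpG, pow_one]
    exact this
  have hcop : Nat.Coprime m p := (Nat.coprime_ordCompl hp.out hn0).symm
  obtain ⟨f, hmf, hpf⟩ := exists_dvd_modEq_one hcop
  have hG : ∀ g : G, g ^ (m * p) = 1 := fun g => by rw [hnm]; exact pow_card_eq_one'
  have hcardP : ∀ Q : Sylow p G, Nat.card Q = p := fun Q => by
    rw [Q.card_eq_multiplicity, hpG, pow_one]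
  have hpnf : ¬ p ∣ f := fun h => by
    have h2 : 0 ≡ 1 [MOD p] := (Nat.modEq_zero_iff_dvd.2 h).symm.trans hpf
    exact hp.out.one_lt.ne' (Nat.dvd_one.1 (Nat.modEq_zero_iff_dvd.1 h2.symm))
  -- As `p` divides `|G|` only once, the valuation merely records whether the `p`-part `g ^ f` is
  -- nontrivial.
  have hval : ∀ g : G, (orderOf g).factorization p = if g ^ f = 1 then 0 else 1 := by
    intro g
    split_ifs with hg
    · exact Nat.factorization_eq_zero_of_not_dvd fun h =>
        hpnf (h.trans (orderOf_dvd_of_pow_eq_one hg))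
    · refine le_antisymm ?_ ?_
      · rw [← hpG]
        exact (Nat.factorization_le_iff_dvd (orderOf_pos g).ne' hn0).2 (orderOf_dvd_natCard g) p
      · refine (hp.out.dvd_iff_one_le_factorization (orderOf_pos g).ne').1 ?_
        by_contra h
        refine hg (orderOf_dvd_iff_pow_eq_one.1 (dvd_trans ?_ hmf))
        exact Nat.Coprime.dvd_of_dvd_mul_right
          ((Nat.Prime.coprime_iff_not_dvd hp.out).2 h).symm (orderOf_dvd_of_pow_eq_one (hG g))
  rw [factorization_prodElementOrders, Finset.sum_congr rfl fun g _ => hval g,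
    sum_comp_pow_eq (fun s : G => if s = 1 then 0 else 1), Finset.mul_sum]
  -- A nontrivial `s` with `s ^ p = 1` lies in exactly one Sylow subgroup, the one it generates; any
  -- other `s ≠ 1` has an empty fibre.
  have hsyl : ∀ s : G, p * ((if s = 1 then 0 else 1) * Nat.card {g : G // g ^ f = s}) =
      ∑ Q : Sylow p G, if s ∈ Q ∧ s ≠ 1 then
        Nat.card (Subgroup.centralizer (P : Set G)) else 0 := by
    intro s
    by_cases hs1 : s = 1
    · simp [hs1]
    by_cases hsp : s ^ p = 1
    · have hpg : IsPGroup p (Subgroup.zpowers s) :=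
        IsPGroup.of_card (n := 1) (by rw [Nat.card_zpowers, orderOf_eq_prime hsp hs1, pow_one])
      obtain ⟨Q, hQ⟩ := hpg.exists_le_sylow
      have hsQ : s ∈ Q := hQ (Subgroup.mem_zpowers s)
      rw [Finset.sum_eq_single Q]
      · rw [if_neg hs1, if_pos ⟨hsQ, hs1⟩, one_mul,
          Q.mul_natCard_pow_fiber (hcardP Q) hG hmf hpf hsQ hs1]
        obtain ⟨g, rfl⟩ := MulAction.exists_smul_eq G P Q
        exact P.natCard_centralizer_smul g
      · intro R _ hRQ
        rw [if_neg]
        rintro ⟨hsR, -⟩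
        refine hRQ (Sylow.ext ?_)
        rw [← Q.zpowers_eq_of_mem (hcardP Q) hsQ hs1, ← R.zpowers_eq_of_mem (hcardP R) hsR hs1]
      · simp
    · rw [natCard_pow_fiber_eq_zero hG hmf hsp, mul_zero, mul_zero, eq_comm]
      refine Finset.sum_eq_zero fun Q _ => if_neg ?_
      rintro ⟨hsQ, -⟩
      refine hsp ?_
      have := pow_card_eq_one' (G := Q) (x := ⟨s, hsQ⟩)
      rw [hcardP] at this
      exact congrArg Subtype.val this
  rw [Finset.sum_congr rfl fun s _ => hsyl s, Finset.sum_comm]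
  have hQ : ∀ Q : Sylow p G, (∑ s : G, if s ∈ Q ∧ s ≠ 1 then
      Nat.card (Subgroup.centralizer (P : Set G)) else 0) =
      (p - 1) * Nat.card (Subgroup.centralizer (P : Set G)) := by
    intro Q
    rw [← Finset.sum_filter, Finset.sum_const, smul_eq_mul]
    congr 1
    have : (Finset.univ.filter fun s : G => s ∈ Q ∧ s ≠ 1) =
        (Finset.univ.filter fun s : G => s ∈ Q).erase 1 := by
      ext s; simp [and_comm]
    rw [this, Finset.card_erase_of_mem (by simp)]
    congr 1
    rw [← Fintype.card_subtype, ← Nat.card_eq_fintype_card]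
    exact hcardP Q
  rw [Finset.sum_congr rfl fun Q _ => hQ Q, Finset.sum_const, smul_eq_mul, Finset.card_univ,
    Nat.card_eq_fintype_card (α := Sylow p G)]

/-- In a group of order `330` or `660` with the exponents of `PSL(2, 11)`, there are `12`
Sylow `11`-subgroups, each of them its own centralizer. -/
theorem natCard_sylow_eleven {G : Type*} [Group G] [Finite G]
    (hG : Nat.card G = 330 ∨ Nat.card G = 660)
    (h11 : (prodElementOrders G).factorization 11 = 120)
    (h5 : (prodElementOrders G).factorization 5 = 264) [Fact (Nat.Prime 11)] (P : Sylow 11 G) :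
    Nat.card G = 660 ∧ Nat.card (Sylow 11 G) = 12 ∧
      Nat.card (Subgroup.centralizer (P : Set G)) = 11 := by
  have : Fintype G := Fintype.ofFinite G
  have hfac : (Nat.card G).factorization 11 = 1 := by
    have hp : Nat.Prime 11 := by norm_num
    rcases hG with hG | hG
    · rw [hG, show 330 = 11 ^ 1 * 30 by norm_num, Nat.factorization_mul (by norm_num) (by norm_num),
        hp.factorization_pow, Finsupp.add_apply, Nat.factorization_eq_zero_of_not_dvd (n := 30)
        (by norm_num)]
      simp
    · rw [hG, show 660 = 11 ^ 1 * 60 by norm_num, Nat.factorization_mul (by norm_num) (by norm_num),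
        hp.factorization_pow, Finsupp.add_apply, Nat.factorization_eq_zero_of_not_dvd (n := 60)
        (by norm_num)]
      simp
  have hmain := P.prime_mul_factorization_prodElementOrders hfac
  rw [h11] at hmain
  have hmod := card_sylow_modEq_one 11 G
  set n := Nat.card (Sylow 11 G) with hn
  set c := Nat.card (Subgroup.centralizer (P : Set G)) with hc
  -- From `11 * 120 = n * (10 * c)`.
  have hnc : n * c = 132 := by nlinarith
  have hcG : c ∣ Nat.card G := Subgroup.card_subgroup_dvd_card _
  have hnG : n ∣ Nat.card G := P.card_dvd_index.trans (Subgroup.index_dvd_card _)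
  have hn132 : n ∈ Nat.divisors 132 := by
    rw [Nat.mem_divisors]; exact ⟨⟨c, hnc.symm⟩, by norm_num⟩
  have hn12 : n = 1 ∨ n = 12 := by
    have : ∀ n ∈ Nat.divisors 132, n % 11 = 1 % 11 → n = 1 ∨ n = 12 := by decide +kernel
    exact this n hn132 hmod
  rcases hn12 with h1 | h1
  · exfalso
    have hc132 : c = 132 := by rw [h1, one_mul] at hnc; exact hnc
    rw [hc132] at hcG
    have hG660 : Nat.card G = 660 := by
      rcases hG with hG | hG
      · rw [hG] at hcG; omega
      · exact hG
    have : Subsingleton (Sylow 11 G) := (Nat.card_eq_one_iff_unique.1 h1).1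
    have hPn : (P : Subgroup G).Normal := P.normal_of_subsingleton
    set C := Subgroup.centralizer (P : Set G) with hCdef
    have hCn : C.Normal := Subgroup.normal_centralizer (H := (P : Subgroup G))
    have hidx : C.index = 5 := by
      have := C.card_mul_index
      rw [← hc, hc132, hG660] at this
      omega
    classical
    -- Elements outside `C` have nontrivial image in the quotient of order `5`. That makes `660 -
    -- 132 = 528` elements of order divisible by `5`, more than `α_5 = 264`.
    have hout : ∀ g : G, (if g ∈ C then 0 else 1) ≤ (orderOf g).factorization 5 := by
      intro g
      split_ifs with hg
      · exact Nat.zero_le _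
      · refine (Nat.Prime.dvd_iff_one_le_factorization (by norm_num) (orderOf_pos g).ne').1 ?_
        have h2 : (QuotientGroup.mk g : G ⧸ C) ≠ 1 := by rwa [Ne, QuotientGroup.eq_one_iff]
        have h3 : (QuotientGroup.mk g : G ⧸ C) ^ 5 = 1 := by
          have := pow_card_eq_one' (G := G ⧸ C) (x := QuotientGroup.mk g)
          rwa [← Subgroup.index_eq_card, hidx] at this
        have : Fact (Nat.Prime 5) := ⟨by norm_num⟩
        rw [← orderOf_eq_prime h3 h2]
        exact orderOf_map_dvd (QuotientGroup.mk' C) g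
    have hsum : ∑ g : G, (if g ∈ C then 1 else 0) = 132 := by
      rw [← hc132, hc, Finset.sum_boole, Nat.cast_id, ← Fintype.card_subtype,
        ← Nat.card_eq_fintype_card]
    have hsum2 : ∑ g : G, (if g ∈ C then 0 else 1) + ∑ g : G, (if g ∈ C then 1 else 0) = 660 := by
      rw [← Finset.sum_add_distrib, ← hG660, Nat.card_eq_fintype_card, ← Finset.card_univ,
        Finset.card_eq_sum_ones]
      refine Finset.sum_congr rfl fun g _ => ?_
      split_ifs <;> rfl
    have hle := Finset.sum_le_sum fun g (_ : g ∈ Finset.univ) => hout g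
    rw [← factorization_prodElementOrders, h5] at hle
    omega
  · refine ⟨?_, h1, by rw [h1] at hnc; omega⟩
    rcases hG with hG | hG
    · rw [hG, h1] at hnG; omega
    · exact hG

/-! ### Permutations of the projective line -/

/-- The permutation `x ↦ x + 1` of the projective line over the field with `11` elements. -/
def translPerm : Equiv.Perm (Option (ZMod 11)) := Equiv.optionCongr (Equiv.addRight 1)

/-- The permutation `x ↦ 3 x` of the projective line over the field with `11` elements. -/
def scalePerm : Equiv.Perm (Option (ZMod 11)) :=
  Equiv.optionCongr ⟨fun x => 3 * x, fun x => 4 * x, by decide +kernel, by decide +kernel⟩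

/-- The map `x ↦ -1 / x` of the projective line over the field with `11` elements. -/
def negInvFun : Option (ZMod 11) → Option (ZMod 11)
  | none => some 0
  -- For nonzero `x` one has `x ^ 10 = 1`, so `x ^ 9` is the inverse of `x`.
  | some x => if x = 0 then none else some (-x ^ 9)

/-- The permutation `x ↦ -1 / x` of the projective line over the field with `11` elements. -/
def negInvPerm : Equiv.Perm (Option (ZMod 11)) :=
  Function.Involutive.toPerm negInvFun (by unfold Function.Involutive; decide +kernel)

theorem translPerm_some (x : ZMod 11) : translPerm (some x) = some (x + 1) := rfl
theorem translPerm_none : translPerm none = none := rfl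
theorem scalePerm_some (x : ZMod 11) : scalePerm (some x) = some (3 * x) := rfl
theorem scalePerm_none : scalePerm none = none := rfl

theorem translPerm_pow_some (i : ℕ) (x : ZMod 11) : (translPerm ^ i) (some x) = some (x + i) := by
  induction i with
  | zero => simp
  | succ i ih =>
    rw [pow_succ', Equiv.Perm.mul_apply, ih, translPerm_some]
    push_cast; ring_nf

theorem translPerm_pow_none (i : ℕ) : (translPerm ^ i) none = none := by
  induction i with
  | zero => simp
  | succ i ih => rw [pow_succ', Equiv.Perm.mul_apply, ih, translPerm_none]

theorem scalePerm_pow_some (i : ℕ) (x : ZMod 11) :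
    (scalePerm ^ i) (some x) = some (3 ^ i * x) := by
  induction i with
  | zero => simp
  | succ i ih =>
    rw [pow_succ', Equiv.Perm.mul_apply, ih, scalePerm_some]
    ring_nf

theorem scalePerm_pow_none (i : ℕ) : (scalePerm ^ i) none = none := by
  induction i with
  | zero => simp
  | succ i ih => rw [pow_succ', Equiv.Perm.mul_apply, ih, scalePerm_none]

/-! ### The action on the twelve Sylow 11-subgroups -/

theorem exists_orderOf_five_conj {G : Type*} [Group G] [Finite G] [Fact (Nat.Prime 11)]
    (P : Sylow 11 G) (hP : Nat.card P = 11)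
    (hN : Nat.card (Subgroup.normalizer (P : Set G)) = 55)
    (hC : Nat.card (Subgroup.centralizer (P : Set G)) = 11) :
    ∃ τ ∈ P, ∃ h : G, orderOf τ = 11 ∧ orderOf h = 5 ∧ h • P = P ∧ h * τ * h⁻¹ = τ ^ 3 := by
  classical
  have f5 : Fact (Nat.Prime 5) := ⟨by norm_num⟩
  obtain ⟨⟨τ, hτP⟩, hτo⟩ := exists_prime_orderOf_dvd_card' (G := P) 11 (by rw [hP])
  rw [Subgroup.orderOf_mk] at hτo
  obtain ⟨⟨g, hgN⟩, hgo⟩ := exists_prime_orderOf_dvd_card'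
    (G := Subgroup.normalizer (P : Set G)) 5 (by rw [hN]; norm_num)
  rw [Subgroup.orderOf_mk] at hgo
  have hτ1 : τ ≠ 1 := by rintro rfl; simp at hτo
  have hz := P.zpowers_eq_of_mem hP hτP hτ1
  have hconj : g * τ * g⁻¹ ∈ Subgroup.zpowers τ := by
    rw [hz]; exact (Subgroup.mem_normalizer_iff.1 hgN τ).1 hτP
  rw [mem_zpowers_iff_mem_range_orderOf, Finset.mem_image] at hconj
  obtain ⟨k, hk, hkτ⟩ := hconj
  rw [hτo, Finset.mem_range] at hk
  have hpow : ∀ j : ℕ, g ^ j * τ * (g ^ j)⁻¹ = τ ^ (k ^ j) := by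
    intro j
    induction j with
    | zero => simp
    | succ j ih =>
      calc g ^ (j + 1) * τ * (g ^ (j + 1))⁻¹ = g * (g ^ j * τ * (g ^ j)⁻¹) * g⁻¹ := by
            rw [pow_succ']; group
        _ = τ ^ (k ^ (j + 1)) := by
            rw [ih, ← conj_pow, ← hkτ, ← pow_mul, pow_succ']
  have hk5 : k ^ 5 % 11 = 1 := by
    have h1 := hpow 5
    rw [← hgo, pow_orderOf_eq_one, one_mul, inv_one, mul_one, hgo] at h1
    have h2 : τ ^ (k ^ 5) = τ ^ 1 := by rw [← h1, pow_one]
    rw [pow_eq_pow_iff_modEq, hτo] at h2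
    exact h2
  have hk1 : k ≠ 1 := by
    rintro rfl
    have hgC : g ∈ Subgroup.centralizer (P : Set G) := by
      rw [Subgroup.mem_centralizer_iff]
      intro y hy
      have hy' : y ∈ Subgroup.zpowers τ := hz ▸ hy
      obtain ⟨j, rfl⟩ := Subgroup.mem_zpowers_iff.1 hy'
      have : Commute τ g := by
        rw [pow_one] at hkτ
        exact (mul_inv_eq_iff_eq_mul.1 hkτ.symm).symm
      exact this.zpow_left j
    have := Subgroup.orderOf_dvd_natCard _ hgC
    rw [hgo, hC] at this
    omega
  -- The residue `k` has order `5` modulo `11`, so its powers are the nonzero squares `1, 3, 4, 5,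
  -- 9`.
  have hj : ∃ j, k ^ j % 11 = 3 := by
    interval_cases k <;> first
      | omega
      | exact ⟨1, rfl⟩
      | exact ⟨2, rfl⟩
      | exact ⟨3, rfl⟩
      | exact ⟨4, rfl⟩
  obtain ⟨j, hj⟩ := hj
  have h3 : g ^ j * τ * (g ^ j)⁻¹ = τ ^ 3 := by
    rw [hpow, pow_eq_pow_iff_modEq, hτo]
    exact hj
  refine ⟨τ, hτP, g ^ j, hτo, orderOf_eq_prime ?_ ?_, ?_, h3⟩
  · rw [← pow_mul, mul_comm, pow_mul, ← hgo, pow_orderOf_eq_one, one_pow]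
  · intro h1
    rw [h1, one_mul, inv_one, mul_one] at h3
    have h2 : τ ^ 1 = τ ^ 3 := by rw [pow_one]; exact h3
    rw [pow_eq_pow_iff_modEq, hτo] at h2
    exact absurd h2 (by decide)
  · rw [Sylow.smul_eq_iff_mem_normalizer]
    exact Subgroup.pow_mem _ hgN j

/-- `P` is labelled `∞`, a second fixed point `Q` of `h` is labelled `0`, and `τ` acts regularly on
the remaining eleven subgroups. Then `h * τ * h⁻¹ = τ ^ 3` forces `h` to act as `x ↦ 3 x`. -/
theorem exists_permHom {G : Type*} [Group G] [Finite G] [Fact (Nat.Prime 11)]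
    (hG : Nat.card G = 660) (hn : Nat.card (Sylow 11 G) = 12)
    (hC : ∀ P : Sylow 11 G, Nat.card (Subgroup.centralizer (P : Set G)) = 11) :
    ∃ (φ : G →* Equiv.Perm (Option (ZMod 11))) (τ h t : G),
      τ ^ 11 = 1 ∧ orderOf h = 5 ∧ φ τ = translPerm ∧ φ h = scalePerm ∧
      φ t none = some 0 ∧ φ t (some 0) = none ∧
      ∀ g, φ g none = none → ∃ i j : ℕ, g = τ ^ i * h ^ j := by
  have f5 : Fact (Nat.Prime 5) := ⟨by norm_num⟩
  have : Fintype (Sylow 11 G) := Fintype.ofFinite _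
  obtain ⟨P⟩ : Nonempty (Sylow 11 G) := inferInstance
  have hN : Nat.card (Subgroup.normalizer (P : Set G)) = 55 := by
    have h1 := P.card_eq_index_normalizer
    have h2 := Subgroup.card_mul_index (Subgroup.normalizer (P : Set G))
    rw [← h1, hn, hG] at h2
    omega
  have hcard : ∀ Q : Sylow 11 G, Nat.card Q = 11 := by
    intro Q
    have hp : Nat.Prime 11 := by norm_num
    rw [Q.card_eq_multiplicity, hG, show 660 = 11 ^ 1 * 60 by norm_num,
      Nat.factorization_mul (by norm_num) (by norm_num),
      hp.factorization_pow, Finsupp.add_apply, Nat.factorization_eq_zero_of_not_dvd (n := 60)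
      (by norm_num)]
    simp
  obtain ⟨τ, hτP, h, hτo, hho, hhP, hhτ⟩ := exists_orderOf_five_conj P (hcard P) hN (hC P)
  -- The number of fixed points of `h` is congruent to `12`, hence to `2`, modulo `5`; so `P` is not
  -- the only one.
  obtain ⟨Q, hQ, hQP⟩ : ∃ Q : Sylow 11 G, h • Q = Q ∧ Q ≠ P := by
    have hpg : IsPGroup 5 (Subgroup.zpowers h) :=
      IsPGroup.of_card (n := 1) (by rw [Nat.card_zpowers, hho, pow_one])
    have hfix := hpg.card_modEq_card_fixedPoints (Sylow 11 G)
    rw [hn] at hfix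
    by_contra hcon
    push Not at hcon
    have hsub : Subsingleton (MulAction.fixedPoints (Subgroup.zpowers h) (Sylow 11 G)) := by
      refine ⟨fun a b => Subtype.ext ?_⟩
      rw [hcon a.1 (a.2 ⟨h, Subgroup.mem_zpowers h⟩), hcon b.1 (b.2 ⟨h, Subgroup.mem_zpowers h⟩)]
    have hle := Finite.card_le_one_iff_subsingleton.2 hsub
    unfold Nat.ModEq at hfix
    omega
  have hτ11 : τ ^ 11 = 1 := by rw [← hτo, pow_orderOf_eq_one]
  have hτ1 : τ ≠ 1 := by rintro rfl; simp at hτo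
  have hτPP : ∀ i : ℕ, τ ^ i • P = P := by
    intro i
    rw [Sylow.smul_eq_iff_mem_normalizer]
    exact Subgroup.le_normalizer (Subgroup.pow_mem _ hτP i)
  have hfree : ∀ g ∈ P, g • Q = Q → g = 1 := by
    intro g hgP hgQ
    by_contra hg1
    have hpg : IsPGroup 11 (P : Subgroup G) := P.isPGroup'
    have h1 := hpg.inf_normalizer_sylow Q
    rw [Sylow.smul_eq_iff_mem_normalizer] at hgQ
    have h2 : g ∈ (P : Subgroup G) ⊓ Subgroup.normalizer (Q : Set G) := ⟨hgP, hgQ⟩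
    have h3 : g ∈ Q := (h1 ▸ h2 : g ∈ (P : Subgroup G) ⊓ (Q : Subgroup G)).2
    exact hQP (Sylow.ext (by
      rw [← Q.zpowers_eq_of_mem (hcard Q) h3 hg1, ← P.zpowers_eq_of_mem (hcard P) hgP hg1]))
  let pt : Option (ZMod 11) → Sylow 11 G := fun x => x.elim P fun i => τ ^ i.val • Q
  have hmodpow : ∀ (i : ℕ) (x : ZMod 11), x = i → τ ^ x.val = τ ^ i := by
    rintro i x rfl
    rw [pow_eq_pow_iff_modEq, hτo, ZMod.val_natCast]
    exact Nat.mod_modEq _ _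
  have hptne : ∀ i : ℕ, τ ^ i • Q ≠ P := by
    intro i hi
    exact hQP (smul_left_cancel _ (hi.trans (hτPP i).symm))
  have hinj : Function.Injective pt := by
    intro x y hxy
    cases x with
    | none =>
      cases y with
      | none => rfl
      | some y => exact absurd hxy.symm (hptne _)
    | some x =>
      cases y with
      | none => exact absurd hxy (hptne _)
      | some y =>
        have hxy' : τ ^ x.val • Q = τ ^ y.val • Q := hxy
        have h1 : ((τ ^ y.val)⁻¹ * τ ^ x.val) • Q = Q := by
          rw [mul_smul, hxy', inv_smul_smul]
        have h2 := hfree _ (P.mul_mem (P.inv_mem (Subgroup.pow_mem _ hτP _))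
          (Subgroup.pow_mem _ hτP _)) h1
        rw [inv_mul_eq_one, pow_eq_pow_iff_modEq, hτo] at h2
        rw [← ZMod.natCast_zmod_val x, ← ZMod.natCast_zmod_val y]
        exact congrArg some ((ZMod.natCast_eq_natCast_iff _ _ _).2 h2.symm)
  have hbij : Function.Bijective pt := by
    rw [Fintype.bijective_iff_injective_and_card]
    refine ⟨hinj, ?_⟩
    rw [← Nat.card_eq_fintype_card (α := Sylow 11 G), hn, Fintype.card_option, ZMod.card]
  let e : Option (ZMod 11) ≃ Sylow 11 G := Equiv.ofBijective pt hbij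
  let φ : G →* Equiv.Perm (Option (ZMod 11)) :=
    (e.symm.permCongrHom.toMonoidHom).comp (MulAction.toPermHom G (Sylow 11 G))
  have hφ : ∀ g x, pt (φ g x) = g • pt x := by
    intro g x
    change e (e.symm (g • e (x))) = _
    rw [Equiv.apply_symm_apply]
    rfl
  have hφ' : ∀ g x y, g • pt x = pt y → φ g x = y := fun g x y hxy => hinj ((hφ g x).trans hxy)
  have hhpow : ∀ j : ℕ, h ^ j • P = P ∧ h ^ j • Q = Q := by
    intro j
    induction j with
    | zero => simp
    | succ j ih => simp only [pow_succ, mul_smul, hhP, hQ, ih, and_self]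
  have hhconj : ∀ i : ℕ, h * τ ^ i = τ ^ (3 * i) * h := by
    intro i
    rw [pow_mul, ← hhτ, conj_pow, inv_mul_cancel_right]
  obtain ⟨g, hg⟩ := MulAction.exists_smul_eq G P Q
  obtain ⟨x, hx⟩ := hbij.2 (g⁻¹ • P)
  cases x with
  | none =>
    exfalso
    have : P = g⁻¹ • P := hx
    rw [eq_inv_smul_iff] at this
    exact hQP (hg.symm.trans this)
  | some x =>
    have hx' : τ ^ x.val • Q = g⁻¹ • P := hx
    -- `τ` fixes `P` and `g` maps `P` to `Q`, while `τ ^ x` maps `Q` to `g⁻¹ • P`; so the product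
    -- swaps `P` and `Q`.
    refine ⟨φ, τ, h, g * τ ^ x.val, hτ11, hho, ?_, ?_, ?_, ?_, ?_⟩
    · ext1 y
      refine hφ' _ _ _ ?_
      cases y with
      | none => have := hτPP 1; rw [pow_one] at this; exact this
      | some y =>
        change τ • τ ^ y.val • Q = τ ^ (y + 1).val • Q
        rw [hmodpow (y.val + 1) (y + 1) (by push_cast; rw [ZMod.natCast_zmod_val]), ← mul_smul,
          pow_succ']
    · ext1 y
      refine hφ' _ _ _ ?_
      cases y with
      | none => exact hhP
      | some y =>
        change h • τ ^ y.val • Q = τ ^ (3 * y).val • Q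
        rw [hmodpow (3 * y.val) (3 * y) (by push_cast; rw [ZMod.natCast_zmod_val]), ← mul_smul,
          hhconj, mul_smul, hQ]
    · refine hφ' _ _ _ ?_
      change (g * τ ^ x.val) • P = τ ^ (0 : ZMod 11).val • Q
      rw [mul_smul, hτPP, hg, ZMod.val_zero, pow_zero, one_smul]
    · refine hφ' _ _ _ ?_
      change (g * τ ^ x.val) • τ ^ (0 : ZMod 11).val • Q = P
      rw [ZMod.val_zero, pow_zero, one_smul, mul_smul, hx', smul_inv_smul]
    · intro c hc
      have hcP : c • P = P := by
        have := hφ c none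
        rw [hc] at this
        exact this.symm
      have hmapN : ∀ y : ZMod 11 × Fin 5,
          τ ^ y.1.val * h ^ y.2.val ∈ Subgroup.normalizer (P : Set G) := by
        intro y
        rw [← Sylow.smul_eq_iff_mem_normalizer, mul_smul, (hhpow _).1, hτPP]
      -- The `55` products `τ ^ i * h ^ j` are distinct, so they exhaust the normalizer of `P`.
      let F : ZMod 11 × Fin 5 → Subgroup.normalizer (P : Set G) := fun y => ⟨_, hmapN y⟩
      have hF : Function.Injective F := by
        rintro ⟨y, i⟩ ⟨z, j⟩ hyz
        have h1 : τ ^ y.val * h ^ i.val = τ ^ z.val * h ^ j.val := congrArg Subtype.val hyz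
        have h2 : some y = some z := by
          refine hinj ?_
          change τ ^ y.val • Q = τ ^ z.val • Q
          have := congrArg (· • Q) h1
          simpa only [mul_smul, (hhpow _).2] using this
        obtain rfl : y = z := Option.some.inj h2
        have h3 := mul_left_cancel h1
        rw [pow_eq_pow_iff_modEq, hho] at h3
        have h4 : i.val = j.val := Nat.ModEq.eq_of_lt_of_lt h3 i.2 j.2
        rw [Fin.ext h4]
      have hFb : Function.Bijective F := by
        have : Fintype (Subgroup.normalizer (P : Set G)) := Fintype.ofFinite _
        rw [Fintype.bijective_iff_injective_and_card]
        refine ⟨hF, ?_⟩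
        rw [← Nat.card_eq_fintype_card (α := Subgroup.normalizer (P : Set G)), hN]
        simp [ZMod.card]
      obtain ⟨y, hy⟩ := hFb.2 ⟨c, Sylow.smul_eq_iff_mem_normalizer.1 hcP⟩
      exact ⟨y.1.val, y.2.val, (congrArg Subtype.val hy).symm⟩

/-! ### Candidates for the element swapping `0` and `∞` -/

/-- The function on the projective line that swaps `0` and `∞`, maps a nonzero square `x` to
`a / x` and a non-square `x` to `-b / x`. -/
def twistedInvFun (a b : ZMod 11) : Option (ZMod 11) → Option (ZMod 11)
  | none => some 0
  | some x => if x = 0 then none else if x ^ 5 = 1 then some (a * x ^ 9) else some (-(b * x ^ 9))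

/-- A check of all pairs `(a, b)`. The word in the hypothesis fixes `∞`, so in the group at hand it
must be affine with a square multiplier; this leaves only `b = -a` with `a` a non-square, which is
`-1 / x` up to a power of `3`. -/
theorem twistedInvFun_classification : ∀ a b : ZMod 11,
    (∀ x, twistedInvFun a b (twistedInvFun a b x) = x) → ∀ i s : ZMod 11, s ^ 5 = 1 →
    (∀ x : ZMod 11, twistedInvFun a b ((twistedInvFun a b
      ((twistedInvFun a b (some x)).map (· + 1))).map (· + -a)) = some (s * x + i)) →
    ∃ l : Fin 5, ∀ x : ZMod 11, twistedInvFun a b (some (3 ^ l.val * x)) = negInvFun (some x) := by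
  decide +kernel

theorem twistedInvFun_none_of_involutive : ∀ a b : ZMod 11,
    twistedInvFun a b (twistedInvFun a b (some 1)) = some 1 →
    twistedInvFun a b ((twistedInvFun a b
      ((twistedInvFun a b none).map (· + 1))).map (· + -a)) = none := by
  decide +kernel

theorem three_pow_five_zmod_eleven : (3 : ZMod 11) ^ 5 = 1 := by decide

/-- The relation says `T (3 x) = T x / 3`. As `3` generates the squares and `-1` is a non-square,
`T` is determined on nonzero elements by `a = T 1` and `b = T (-1)`. -/
theorem eq_twistedInvFun {T : Equiv.Perm (Option (ZMod 11))} (h0 : T none = some 0)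
    (h1 : T (some 0) = none) (hT : scalePerm * T * scalePerm = T) :
    ∃ a b, ∀ x, T x = twistedInvFun a b x := by
  have hne : ∀ x : ZMod 11, x ≠ 0 → ∃ y, T (some x) = some y := by
    intro x hx
    cases hTx : T (some x) with
    | none => exact absurd (Option.some.inj (T.injective (hTx.trans h1.symm))) hx
    | some y => exact ⟨y, rfl⟩
  obtain ⟨a, ha⟩ := hne 1 (by decide)
  obtain ⟨b, hb⟩ := hne (-1) (by decide)
  have hstep : ∀ x y : ZMod 11, T (some x) = some y → T (some (3 * x)) = some (4 * y) := by
    intro x y hxy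
    have := DFunLike.congr_fun hT (some x)
    rw [Equiv.Perm.mul_apply, Equiv.Perm.mul_apply, scalePerm_some, hxy] at this
    refine scalePerm.injective (this.trans ?_)
    rw [scalePerm_some, ← mul_assoc]
    congr 1
    rw [show (3 * 4 : ZMod 11) = 1 by decide, one_mul]
  have hpow : ∀ (x y : ZMod 11) (i : ℕ), T (some x) = some y →
      T (some (3 ^ i * x)) = some (4 ^ i * y) := by
    intro x y i hxy
    induction i with
    | zero => simpa using hxy
    | succ i ih => rw [pow_succ', pow_succ', mul_assoc, mul_assoc]; exact hstep _ _ ih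
  refine ⟨a, b, fun x => ?_⟩
  cases x with
  | none => exact h0
  | some x =>
    by_cases hx : x = 0
    · rw [hx, h1]; rfl
    have hcover : ∀ x : ZMod 11, x ≠ 0 → ∃ i : Fin 5, x = 3 ^ i.val * 1 ∨ x = 3 ^ i.val * -1 := by
      decide
    have hsq : ∀ (a b : ZMod 11) (i : Fin 5),
        twistedInvFun a b (some (3 ^ i.val * 1)) = some (4 ^ i.val * a) ∧
        twistedInvFun a b (some (3 ^ i.val * -1)) = some (4 ^ i.val * b) := by decide +kernel
    obtain ⟨i, rfl | rfl⟩ := hcover x hx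
    · rw [hpow 1 a i ha, (hsq a b i).1]
    · rw [hpow (-1) b i hb, (hsq a b i).2]

/-! ### Stabilizers and the relations between `h` and `t` -/

theorem apply_pow_mul_pow {G : Type*} [Group G] {φ : G →* Equiv.Perm (Option (ZMod 11))}
    {τ h : G} (hτ : φ τ = translPerm) (hh : φ h = scalePerm) (i j : ℕ) (x : ZMod 11) :
    φ (τ ^ i * h ^ j) (some x) = some (3 ^ j * x + i) := by
  rw [map_mul, map_pow, map_pow, hτ, hh, Equiv.Perm.mul_apply, scalePerm_pow_some,
    translPerm_pow_some]

theorem exists_eq_pow_of_fix {G : Type*} [Group G] {φ : G →* Equiv.Perm (Option (ZMod 11))}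
    {τ h : G} (hτ11 : τ ^ 11 = 1) (hτ : φ τ = translPerm) (hh : φ h = scalePerm)
    (hstab : ∀ g, φ g none = none → ∃ i j : ℕ, g = τ ^ i * h ^ j) {g : G}
    (hg : φ g none = none) (hg0 : φ g (some 0) = some 0) : ∃ j : ℕ, g = h ^ j := by
  obtain ⟨i, j, rfl⟩ := hstab g hg
  rw [apply_pow_mul_pow hτ hh, mul_zero, zero_add] at hg0
  have hi := (ZMod.natCast_eq_zero_iff i 11).1 (Option.some.inj hg0)
  obtain ⟨k, rfl⟩ := hi
  exact ⟨j, by rw [pow_mul, hτ11, one_pow, one_mul]⟩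

theorem injective_of_stabilizer {G : Type*} [Group G] {φ : G →* Equiv.Perm (Option (ZMod 11))}
    {τ h : G} (hτ11 : τ ^ 11 = 1) (hh5 : orderOf h = 5)
    (hτ : φ τ = translPerm) (hh : φ h = scalePerm)
    (hstab : ∀ g, φ g none = none → ∃ i j : ℕ, g = τ ^ i * h ^ j) :
    Function.Injective φ := by
  rw [injective_iff_map_eq_one]
  intro g hg
  obtain ⟨j, rfl⟩ := exists_eq_pow_of_fix hτ11 hτ hh hstab (g := g) (by rw [hg]; rfl)
    (by rw [hg]; rfl)
  have h1 : (scalePerm ^ j) (some 1) = some 1 := by rw [← hh, ← map_pow, hg]; rfl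
  rw [scalePerm_pow_some, mul_one, Option.some.injEq, ← Nat.mod_add_div j 5, pow_add, pow_mul,
    show (3 : ZMod 11) ^ 5 = 1 by decide, one_pow, mul_one] at h1
  have h2 : ∀ k < 5, (3 : ZMod 11) ^ k = 1 → k = 0 := by decide
  rw [← orderOf_dvd_iff_pow_eq_one, hh5]
  exact Nat.dvd_of_mod_eq_zero (h2 _ (Nat.mod_lt _ (by norm_num)) h1)

/-- An element swapping the two fixed points of `h` does not commute with `h`. -/
theorem not_commute_of_swap {G : Type*} [Group G] [Finite G] (hG : Nat.card G = 660)
    (h5 : (prodElementOrders G).factorization 5 = 264)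
    {φ : G →* Equiv.Perm (Option (ZMod 11))} {τ h t : G} (hτ11 : τ ^ 11 = 1) (hh5 : orderOf h = 5)
    (hτ : φ τ = translPerm) (hh : φ h = scalePerm) (ht : φ t none = some 0)
    (ht0 : φ t (some 0) = none)
    (hstab : ∀ g, φ g none = none → ∃ i j : ℕ, g = τ ^ i * h ^ j) : ¬ Commute t h := by
  intro hcomm
  have f5 : Fact (Nat.Prime 5) := ⟨by norm_num⟩
  have hfac : (Nat.card G).factorization 5 = 1 := by
    rw [hG, show 660 = 5 ^ 1 * 132 by norm_num, Nat.factorization_mul (by norm_num) (by norm_num),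
      f5.out.factorization_pow, Finsupp.add_apply,
      Nat.factorization_eq_zero_of_not_dvd (n := 132) (by norm_num)]
    simp
  have hpg : IsPGroup 5 (Subgroup.zpowers h) :=
    IsPGroup.of_card (n := 1) (by rw [Nat.card_zpowers, hh5, pow_one])
  obtain ⟨R, hR⟩ := hpg.exists_le_sylow
  have hRcard : Nat.card R = 5 := by rw [R.card_eq_multiplicity, hfac, pow_one]
  have hhR : h ∈ R := hR (Subgroup.mem_zpowers h)
  have hh1 : h ≠ 1 := by rintro rfl; simp at hh5
  have hz := R.zpowers_eq_of_mem hRcard hhR hh1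
  have hmain := R.prime_mul_factorization_prodElementOrders hfac
  rw [h5] at hmain
  have hmod := card_sylow_modEq_one 5 G
  set n := Nat.card (Sylow 5 G)
  set C := Subgroup.centralizer (R : Set G) with hC
  have hnc : n * Nat.card C = 330 := by nlinarith
  have hCh : ∀ c ∈ C, Commute h c := fun c hc => Subgroup.mem_centralizer_iff.1 hc h hhR
  have hmemC : ∀ c, Commute h c → c ∈ C := by
    intro c hc
    rw [hC, Subgroup.mem_centralizer_iff]
    intro y hy
    have hy' : y ∈ Subgroup.zpowers h := hz ▸ hy
    obtain ⟨j, rfl⟩ := Subgroup.mem_zpowers_iff.1 hy'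
    exact hc.zpow_left j
  have hfix : ∀ c ∈ C, φ c none = none ∧ φ c (some 0) = some 0 ∨ φ c none = some 0 := by
    intro c hc
    have key : ∀ x, scalePerm x = x → scalePerm (φ c x) = φ c x := by
      intro x hx
      have := DFunLike.congr_fun (congrArg φ (hCh c hc).eq) x
      rw [map_mul, map_mul, Equiv.Perm.mul_apply, Equiv.Perm.mul_apply, hh, hx] at this
      exact this
    have hsc : ∀ x, scalePerm x = x → x = none ∨ x = some 0 := by decide +kernel
    have h1 := hsc _ (key none rfl)
    have h2 := hsc _ (key (some 0) rfl)
    rcases h1 with h1 | h1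
    · refine Or.inl ⟨h1, ?_⟩
      rcases h2 with h2 | h2
      · exact absurd ((φ c).injective (h1.trans h2.symm)) (by simp)
      · exact h2
    · exact Or.inr h1
  have htC : t ∈ C := hmemC t hcomm.symm
  have hswap0 : ∀ c ∈ C, φ c none = some 0 → φ c (some 0) = none := by
    intro c hc h1
    have h2 := hfix (c * t) (C.mul_mem hc htC)
    rw [map_mul, Equiv.Perm.mul_apply, Equiv.Perm.mul_apply, ht, ht0] at h2
    rcases h2 with h2 | h2
    · exact h2.1
    · exact absurd ((φ c).injective (h2.trans h1.symm)) (by simp)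
  -- An element of `C` preserves the fixed points `0`, `∞` of `h`. If it fixes both it lies in
  -- `⟨h⟩`; if it swaps them, its product with `t` does.
  have hle : Nat.card C ≤ 10 := by
    have hsurj : ∀ c ∈ C, ∃ y : Fin 2 × Fin 5, t⁻¹ ^ y.1.val * h ^ y.2.val = c := by
      intro c hc
      have hred : ∀ j : ℕ, h ^ j = h ^ (j % 5) := fun j => by rw [← hh5, pow_mod_orderOf]
      rcases hfix c hc with h1 | h1
      · obtain ⟨j, rfl⟩ := exists_eq_pow_of_fix hτ11 hτ hh hstab h1.1 h1.2
        exact ⟨(0, ⟨j % 5, Nat.mod_lt _ (by norm_num)⟩), by simp [← hred]⟩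
      · obtain ⟨j, hj⟩ := exists_eq_pow_of_fix hτ11 hτ hh hstab (g := t * c)
          (by rw [map_mul, Equiv.Perm.mul_apply, h1, ht0])
          (by rw [map_mul, Equiv.Perm.mul_apply, hswap0 c hc h1, ht])
        exact ⟨(1, ⟨j % 5, Nat.mod_lt _ (by norm_num)⟩), by simp [← hred, ← hj]⟩
    choose f hf using hsurj
    have hinj : Function.Injective fun c : C => f c.1 c.2 := by
      intro c d hcd
      apply Subtype.ext
      rw [← hf c.1 c.2, ← hf d.1 d.2]
      exact congrArg (fun y : Fin 2 × Fin 5 => t⁻¹ ^ y.1.val * h ^ y.2.val) hcd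
    have := Nat.card_le_card_of_injective _ hinj
    simpa using this
  have h5C : Nat.card R ∣ Nat.card C := by
    refine Subgroup.card_dvd_of_le fun x hx => hmemC x ?_
    have hx' : x ∈ Subgroup.zpowers h := hz ▸ hx
    obtain ⟨j, rfl⟩ := Subgroup.mem_zpowers_iff.1 hx'
    exact (Commute.refl h).zpow_right j
  rw [hRcard] at h5C
  obtain ⟨k, hk⟩ := h5C
  unfold Nat.ModEq at hmod
  have hk2 : k ≤ 2 := by omega
  -- Here `|C| = 5 k`. For `k = 1`, `t` would lie in `⟨h⟩`, which fixes `∞`; for `k = 2` there would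
  -- be `33` Sylow 5-subgroups, but `33` is not `1` modulo `5`.
  interval_cases k
  · rw [hk] at hnc; omega
  · have hCR : (R : Subgroup G) = C := by
      refine Subgroup.eq_of_le_of_card_ge (fun x hx => hmemC x ?_) (by rw [hk, hRcard])
      have hx' : x ∈ Subgroup.zpowers h := hz ▸ hx
      obtain ⟨j, rfl⟩ := Subgroup.mem_zpowers_iff.1 hx'
      exact (Commute.refl h).zpow_right j
    have htz : t ∈ Subgroup.zpowers h := by rw [hz, hCR]; exact htC
    obtain ⟨j, hj⟩ := (mem_powers_iff_mem_zpowers.2 htz)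
    have hj' : h ^ j = t := hj
    rw [← hj', map_pow, hh, scalePerm_pow_none] at ht
    exact absurd ht (by simp)
  · rw [hk] at hnc
    omega

/-- Both `t * t` and `t * h * t⁻¹` fix `0` and `∞`, hence are powers of `h`. So `t` acts on `⟨h⟩`
with order at most two, and nontrivially, which means by inversion. -/
theorem swap_relations {G : Type*} [Group G] [Finite G] (hG : Nat.card G = 660)
    (h5 : (prodElementOrders G).factorization 5 = 264)
    {φ : G →* Equiv.Perm (Option (ZMod 11))} {τ h t : G} (hτ11 : τ ^ 11 = 1) (hh5 : orderOf h = 5)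
    (hτ : φ τ = translPerm) (hh : φ h = scalePerm) (ht : φ t none = some 0)
    (ht0 : φ t (some 0) = none)
    (hstab : ∀ g, φ g none = none → ∃ i j : ℕ, g = τ ^ i * h ^ j) :
    t * t = 1 ∧ h * t * h = t := by
  have hcomm := not_commute_of_swap hG h5 hτ11 hh5 hτ hh ht ht0 hstab
  have hti : φ t⁻¹ none = some 0 := by rw [map_inv, Equiv.Perm.inv_eq_iff_eq, ht0]
  have hti0 : φ t⁻¹ (some 0) = none := by rw [map_inv, Equiv.Perm.inv_eq_iff_eq, ht]
  obtain ⟨i, hi⟩ := exists_eq_pow_of_fix hτ11 hτ hh hstab (g := t * t)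
    (by rw [map_mul, Equiv.Perm.mul_apply, ht, ht0])
    (by rw [map_mul, Equiv.Perm.mul_apply, ht0, ht])
  obtain ⟨j, hj⟩ := exists_eq_pow_of_fix hτ11 hτ hh hstab (g := t * h * t⁻¹)
    (by rw [map_mul, map_mul, Equiv.Perm.mul_apply, Equiv.Perm.mul_apply, hti, hh, scalePerm_some,
      mul_zero, ht0])
    (by rw [map_mul, map_mul, Equiv.Perm.mul_apply, Equiv.Perm.mul_apply, hti0, hh,
      scalePerm_none, ht])
  have hjj : h ^ (j * j) = h ^ 1 := by
    calc h ^ (j * j) = t * (t * h * t⁻¹) * t⁻¹ := by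
          rw [pow_mul, ← hj, conj_pow, ← hj]
      _ = (t * t) * h * (t * t)⁻¹ := by group
      _ = h ^ 1 := by rw [hi, pow_one, ((Commute.refl h).pow_left i).eq, mul_inv_cancel_right]
  rw [pow_eq_pow_iff_modEq, hh5] at hjj
  have hj1 : j % 5 ≠ 1 := by
    intro hj5
    apply hcomm
    have h1 : h ^ j = h := by
      conv_rhs => rw [← pow_one h]
      rw [pow_eq_pow_iff_modEq, hh5]; exact hj5
    rw [h1] at hj
    exact mul_inv_eq_iff_eq_mul.1 hj
  have hj4 : j % 5 = 4 := by
    have h1 : (j % 5) * (j % 5) % 5 = 1 := by rw [← Nat.mul_mod]; exact hjj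
    have h2 : j % 5 < 5 := Nat.mod_lt _ (by norm_num)
    interval_cases j % 5 <;> omega
  have hinv : t * h * t⁻¹ = h⁻¹ := by
    rw [hj, eq_inv_iff_mul_eq_one, ← pow_succ, ← orderOf_dvd_iff_pow_eq_one, hh5]
    omega
  refine ⟨?_, ?_⟩
  -- `t * t` is a power of `h` both centralized and inverted by `t`, hence trivial because `5` is
  -- odd.
  · have h1 : h ^ i = (h ^ i)⁻¹ := by
      calc h ^ i = t * (t * t) * t⁻¹ := by rw [← hi]; group
        _ = (h ^ i)⁻¹ := by rw [hi, ← conj_pow, hinv, inv_pow]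
    rw [hi, ← orderOf_dvd_iff_pow_eq_one, hh5]
    rw [eq_inv_iff_mul_eq_one, ← pow_add, ← orderOf_dvd_iff_pow_eq_one, hh5] at h1
    omega
  · have h1 : t * h = h⁻¹ * t := mul_inv_eq_iff_eq_mul.1 hinv
    rw [mul_assoc, h1, mul_inv_cancel_left]

/-! ### Uniqueness of the permutation group -/

/-- The target does not depend on `G`, so any two groups with these exponents are isomorphic; no
action of `PSL(2, 11)` has to be identified by hand. -/
theorem nonempty_mulEquiv_closure {G : Type*} [Group G] [Finite G]
    (hexp : expRho G = {120, 165, 220, 264}) :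
    Nonempty (G ≃* Subgroup.closure ({translPerm, scalePerm, negInvPerm} :
      Set (Equiv.Perm (Option (ZMod 11))))) := by
  obtain ⟨hcard, h11, h5⟩ := natCard_and_factorization_of_expRho_eq hexp
  have f11 : Fact (Nat.Prime 11) := ⟨by norm_num⟩
  have hsyl := fun P : Sylow 11 G => natCard_sylow_eleven hcard h11 h5 P
  obtain ⟨P⟩ : Nonempty (Sylow 11 G) := inferInstance
  have hG := (hsyl P).1
  obtain ⟨φ, τ, h, t, hτ11, hh5, hτ, hh, ht, ht0, hstab⟩ :=
    exists_permHom hG (hsyl P).2.1 fun Q => (hsyl Q).2.2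
  obtain ⟨htt, hht⟩ := swap_relations hG h5 hτ11 hh5 hτ hh ht ht0 hstab
  have hinj := injective_of_stabilizer hτ11 hh5 hτ hh hstab
  obtain ⟨a, b, hT⟩ := eq_twistedInvFun ht ht0 (by rw [← hh, ← map_mul, ← map_mul, hht])
  have hτm : ∀ (y : ZMod 11) x, φ (τ ^ y.val) x = x.map (· + y) := by
    intro y x
    rw [map_pow, hτ]
    cases x with
    | none => rw [translPerm_pow_none]; rfl
    | some x => rw [translPerm_pow_some, ZMod.natCast_zmod_val]; rfl
  have hτ1 : ∀ x, φ τ x = x.map (· + 1) := by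
    intro x
    rw [hτ]
    cases x <;> rfl
  have hinvol : ∀ x, twistedInvFun a b (twistedInvFun a b x) = x := by
    intro x
    rw [← hT, ← hT, ← Equiv.Perm.mul_apply, ← map_mul, htt, map_one, Equiv.Perm.one_apply]
  -- This word moves `∞` along `∞, 0, 1, a, 0, ∞`, so it lies in the stabilizer of `∞`.
  have hw : ∀ x, φ (t * τ ^ (-a).val * t * τ * t) x = twistedInvFun a b ((twistedInvFun a b
      ((twistedInvFun a b x).map (· + 1))).map (· + -a)) := by
    intro x
    simp only [map_mul, Equiv.Perm.mul_apply]
    rw [hT, hT, hT, hτ1, hτm]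
  obtain ⟨i, j, hij⟩ := hstab _ ((hw none).trans (twistedInvFun_none_of_involutive a b (hinvol _)))
  have hl := twistedInvFun_classification a b hinvol i (3 ^ j)
    (by rw [← pow_mul, mul_comm, pow_mul, three_pow_five_zmod_eleven, one_pow])
    (fun x => by rw [← hw, hij, apply_pow_mul_pow hτ hh])
  obtain ⟨l, hl⟩ := hl
  have hs : φ (t * h ^ l.val) = negInvPerm := by
    ext1 x
    rw [map_mul, map_pow, hh, Equiv.Perm.mul_apply]
    cases x with
    | none => rw [scalePerm_pow_none, ht]; rfl
    | some x => rw [scalePerm_pow_some, hT, hl]; rfl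
  have hgen : Subgroup.closure ({τ, h, t * h ^ l.val} : Set G) = ⊤ := by
    set K := Subgroup.closure ({τ, h, t * h ^ l.val} : Set G)
    have hτK : τ ∈ K := Subgroup.subset_closure (by simp)
    have hhK : h ∈ K := Subgroup.subset_closure (by simp)
    have htK : t * h ^ l.val ∈ K := Subgroup.subset_closure (by simp)
    have hstK : ∀ g, φ g none = none → g ∈ K := by
      intro g hg
      obtain ⟨i, j, rfl⟩ := hstab g hg
      exact K.mul_mem (K.pow_mem hτK i) (K.pow_mem hhK j)
    rw [Subgroup.eq_top_iff']
    intro g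
    cases hg : φ g none with
    | none => exact hstK g hg
    | some x =>
      -- If `g` sends `∞` to `x`, translating by `-x` and applying `-1 / x` brings the image back to
      -- `∞`.
      have h1 : φ ((t * h ^ l.val) * (τ ^ (-x).val * g)) none = none := by
        rw [map_mul, Equiv.Perm.mul_apply, hs, map_mul, Equiv.Perm.mul_apply, hg, hτm]
        simp only [Option.map_some, add_neg_cancel]
        rfl
      have h2 := (K.mul_mem_cancel_left htK).1 (hstK _ h1)
      exact (K.mul_mem_cancel_left (K.pow_mem hτK _)).1 h2
  have hrange : φ.range = Subgroup.closure ({translPerm, scalePerm, negInvPerm} :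
      Set (Equiv.Perm (Option (ZMod 11)))) := by
    rw [MonoidHom.range_eq_map, ← hgen, MonoidHom.map_closure]
    congr 1
    simp only [Set.image_insert_eq, Set.image_singleton, hτ, hh, hs]
  exact ⟨(MonoidHom.ofInjective hinj).trans (MulEquiv.subgroupCongr hrange)⟩

/-! ### Element orders in `PSL(2, 11)` and the value of `ρ` -/

/-- The sequence `u` with `u 0 = 0`, `u 1 = 1` and `u (n + 2) = t * u (n + 1) - u n`. -/
def lucasSeq (t : ZMod 11) : ℕ → ZMod 11
  | 0 => 0
  | 1 => 1
  | n + 2 => t * lucasSeq t (n + 1) - lucasSeq t n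

/-- The order in `PSL(2, 11)` of the image of a non-scalar matrix of trace `t`. -/
def traceOrder (t : ZMod 11) : ℕ :=
  if t ^ 2 = 0 then 2 else if t ^ 2 = 1 then 3 else if t ^ 2 = 3 then 6 else
    if t ^ 2 = 4 then 11 else 5

theorem lucasSeq_traceOrder : ∀ t, 0 < traceOrder t ∧ lucasSeq t (traceOrder t) = 0 ∧
    ∀ m < traceOrder t, 0 < m → lucasSeq t m ≠ 0 := by
  decide +kernel

theorem prod_traceOrder : (∏ a : ZMod 11, ∏ b : ZMod 11, ∏ c : ZMod 11, ∏ d : ZMod 11,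
    if a * d - b * c = 1 then (if b = 0 ∧ c = 0 ∧ a = d then 1 else traceOrder (a + d)) else 1) =
    (2 ^ 165 * 3 ^ 220 * 5 ^ 264 * 11 ^ 120) ^ 2 := by
  decide +kernel

/-- Iterates the Cayley–Hamilton relation `A * A = A.trace • A - 1`. -/
theorem Matrix.pow_succ_eq_lucasSeq (A : Matrix (Fin 2) (Fin 2) (ZMod 11)) (hA : A.det = 1)
    (n : ℕ) : A ^ (n + 1) = lucasSeq A.trace (n + 1) • A - lucasSeq A.trace n • 1 := by
  have hsq : A * A = A.trace • A - 1 := by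
    rw [Matrix.det_fin_two] at hA
    ext i j
    fin_cases i <;> fin_cases j <;>
      simp [Matrix.mul_apply, Fin.sum_univ_two, Matrix.trace_fin_two] <;>
      first | linear_combination -hA | ring1
  induction n with
  | zero => simp [lucasSeq]
  | succ n ih =>
    rw [pow_succ, ih, sub_mul, smul_mul_assoc, hsq, smul_mul_assoc, one_mul]
    simp only [lucasSeq, sub_smul, smul_sub, smul_smul, mul_comm]
    abel

theorem Matrix.SpecialLinearGroup.mem_center_fin_two_iff
    {A : Matrix.SpecialLinearGroup (Fin 2) (ZMod 11)} :
    A ∈ Subgroup.center (Matrix.SpecialLinearGroup (Fin 2) (ZMod 11)) ↔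
      A.1 0 1 = 0 ∧ A.1 1 0 = 0 ∧ A.1 0 0 = A.1 1 1 := by
  rw [Matrix.SpecialLinearGroup.mem_center_iff]
  constructor
  · rintro ⟨r, -, hr⟩
    rw [← hr]
    simp
  · rintro ⟨h1, h2, h3⟩
    refine ⟨A.1 0 0, ?_, ?_⟩
    · have := A.2
      rw [Matrix.det_fin_two, h1, ← h3, zero_mul, sub_zero] at this
      rw [Fintype.card_fin, sq, this]
    · ext i j
      fin_cases i <;> fin_cases j <;> simp [h1, h2, h3]

/-- For non-scalar `A`, the power `A ^ n` with `n > 0` is scalar exactly when the coefficient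
`lucasSeq A.trace n` of `A` vanishes, so the order is the first positive zero of the sequence. -/
theorem orderOf_mk_PSL211 {A : Matrix.SpecialLinearGroup (Fin 2) (ZMod 11)}
    (hA : A ∉ Subgroup.center (Matrix.SpecialLinearGroup (Fin 2) (ZMod 11))) :
    orderOf (QuotientGroup.mk A : PSL211) = traceOrder A.1.trace := by
  have key : ∀ n, (QuotientGroup.mk A : PSL211) ^ (n + 1) = 1 ↔ lucasSeq A.1.trace (n + 1) = 0 := by
    intro n
    rw [← QuotientGroup.mk_pow, QuotientGroup.eq_one_iff,
      Matrix.SpecialLinearGroup.mem_center_fin_two_iff]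
    have h := A.1.pow_succ_eq_lucasSeq A.2 n
    have hcoe : (A ^ (n + 1)).1 = A.1 ^ (n + 1) := Matrix.SpecialLinearGroup.coe_pow A (n + 1)
    rw [hcoe, h]
    constructor
    · intro hs
      by_contra hu
      rw [Matrix.SpecialLinearGroup.mem_center_fin_two_iff] at hA
      apply hA
      have : Fact (Nat.Prime 11) := ⟨by norm_num⟩
      simpa [hu, sub_left_inj] using hs
    · intro hu
      simp [hu]
  obtain ⟨hpos, hzero, hne⟩ := lucasSeq_traceOrder A.1.trace
  rw [orderOf_eq_iff hpos]
  constructor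
  · obtain ⟨k, hk⟩ := Nat.exists_eq_succ_of_ne_zero hpos.ne'
    rw [hk] at hzero ⊢
    exact (key k).2 hzero
  · intro m hm hm0
    obtain ⟨k, rfl⟩ := Nat.exists_eq_succ_of_ne_zero hm0.ne'
    rw [Ne, key k]
    exact hne _ hm hm0

theorem QuotientGroup.prod_comp_mk {G M : Type*} [Group G] [Fintype G] [CommMonoid M]
    (N : Subgroup G) [Fintype (G ⧸ N)] (φ : G ⧸ N → M) :
    ∏ g : G, φ (QuotientGroup.mk g) = (∏ q, φ q) ^ Nat.card N := by
  classical
  rw [← Finset.prod_fiberwise Finset.univ (QuotientGroup.mk : G → G ⧸ N), ← Finset.prod_pow]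
  refine Finset.prod_congr rfl fun q _ => ?_
  have hq : ∀ g ∈ Finset.univ.filter (fun g : G => (QuotientGroup.mk g : G ⧸ N) = q),
      φ (QuotientGroup.mk g) = φ q := fun g hg => by rw [(Finset.mem_filter.1 hg).2]
  rw [Finset.prod_congr rfl hq, Finset.prod_const]
  congr 1
  have h := QuotientGroup.card_preimage_mk N {q}
  have hone : Nat.card ({q} : Set (G ⧸ N)) = 1 := Nat.card_unique
  rw [hone, mul_one] at h
  rw [← h, ← Fintype.card_subtype, ← Nat.card_eq_fintype_card]
  rfl

theorem natCard_center_SL211 :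
    Nat.card (Subgroup.center (Matrix.SpecialLinearGroup (Fin 2) (ZMod 11))) = 2 := by
  have : Fact (Nat.Prime 11) := ⟨by norm_num⟩
  rw [Nat.card_congr (Matrix.SpecialLinearGroup.center_equiv_rootsOfUnity' (0 : Fin 2)).toEquiv,
    Fintype.card_fin]
  exact (IsPrimitiveRoot.neg_one 11 (by norm_num) :
    IsPrimitiveRoot (-1 : ZMod 11) 2).card_rootsOfUnity

theorem prod_SL211 [Fintype (Matrix.SpecialLinearGroup (Fin 2) (ZMod 11))]
    (w : ZMod 11 → ZMod 11 → ZMod 11 → ZMod 11 → ℕ) :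
    ∏ A : Matrix.SpecialLinearGroup (Fin 2) (ZMod 11),
        w (A.1 0 0) (A.1 0 1) (A.1 1 0) (A.1 1 1) =
      ∏ a, ∏ b, ∏ c, ∏ d, if a * d - b * c = 1 then w a b c d else 1 := by
  have h : ∀ x : ZMod 11 × ZMod 11 × ZMod 11 × ZMod 11,
      x ∈ Finset.univ.filter (fun x : ZMod 11 × ZMod 11 × ZMod 11 × ZMod 11 =>
        x.1 * x.2.2.2 - x.2.1 * x.2.2.1 = 1) ↔ x.1 * x.2.2.2 - x.2.1 * x.2.2.1 = 1 := by simp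
  simp_rw [← Fintype.prod_prod_type']
  rw [← Finset.prod_filter]
  refine Finset.prod_bij' (fun A _ => (A.1 0 0, A.1 0 1, A.1 1 0, A.1 1 1))
    (fun x hx => (⟨!![x.1, x.2.1; x.2.2.1, x.2.2.2], by
      rw [Matrix.det_fin_two_of]; exact (h x).1 hx⟩ :
        Matrix.SpecialLinearGroup (Fin 2) (ZMod 11))) ?_ ?_ ?_ ?_ ?_
  · intro A _
    rw [h]
    have := A.2
    rwa [Matrix.det_fin_two] at this
  · intro x hx
    exact Finset.mem_univ _
  · intro A _
    ext i j
    fin_cases i <;> fin_cases j <;> rfl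
  · intro x _
    rfl
  · intro A _
    rfl

theorem prodElementOrders_PSL211 :
    prodElementOrders PSL211 = 2 ^ 165 * 3 ^ 220 * 5 ^ 264 * 11 ^ 120 := by
  have : Fintype PSL211 := Fintype.ofFinite _
  -- Each element has two lifts to `SL(2, 11)`, so the product over matrices computes the square of
  -- `ρ`.
  refine Nat.pow_left_injective (n := 2) (by norm_num) ?_
  simp only []
  have h := QuotientGroup.prod_comp_mk _ (fun q : PSL211 => orderOf q)
  rw [natCard_center_SL211] at h
  rw [prodElementOrders_eq_prod, ← h, ← prod_traceOrder,
    ← prod_SL211 fun a b c d => if b = 0 ∧ c = 0 ∧ a = d then 1 else traceOrder (a + d)]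
  refine Finset.prod_congr rfl fun A _ => ?_
  split_ifs with hA
  · rw [← Matrix.SpecialLinearGroup.mem_center_fin_two_iff] at hA
    rw [orderOf_eq_one_iff]
    exact (QuotientGroup.eq_one_iff A).2 hA
  · rw [← Matrix.SpecialLinearGroup.mem_center_fin_two_iff] at hA
    rw [orderOf_mk_PSL211 hA, Matrix.trace_fin_two]

theorem expRho_PSL211 : expRho PSL211 = {120, 165, 220, 264} := by
  have p2 : Nat.Prime 2 := by norm_num
  have p3 : Nat.Prime 3 := by norm_num
  have p5 : Nat.Prime 5 := by norm_num
  have p11 : Nat.Prime 11 := by norm_num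
  have hpf : (2 ^ 165 * 3 ^ 220 * 5 ^ 264 * 11 ^ 120).primeFactors = {2, 3, 5, 11} := by
    rw [Nat.primeFactors_mul (by positivity) (by positivity),
      Nat.primeFactors_mul (by positivity) (by positivity),
      Nat.primeFactors_mul (by positivity) (by positivity),
      Nat.primeFactors_prime_pow (by norm_num) p2, Nat.primeFactors_prime_pow (by norm_num) p3,
      Nat.primeFactors_prime_pow (by norm_num) p5, Nat.primeFactors_prime_pow (by norm_num) p11]
    rfl
  have hfac : (2 ^ 165 * 3 ^ 220 * 5 ^ 264 * 11 ^ 120).factorization =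
      Finsupp.single 2 165 + Finsupp.single 3 220 + Finsupp.single 5 264 +
        Finsupp.single 11 120 := by
    rw [Nat.factorization_mul (by positivity) (by positivity),
      Nat.factorization_mul (by positivity) (by positivity),
      Nat.factorization_mul (by positivity) (by positivity),
      p2.factorization_pow, p3.factorization_pow, p5.factorization_pow, p11.factorization_pow]
  rw [expRho, primeExponents, prodElementOrders_PSL211, hpf, hfac]
  simp only [Finset.image_insert, Finset.image_singleton, Finsupp.add_apply, Finsupp.single_apply]
  decide

theorem mainTheorem4 :
    expRho PSL211 = {120, 165, 220, 264} ∧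
      ∀ (G : Type*) [Group G] [Finite G],
        Nonempty (G ≃* PSL211) ↔ expRho G = expRho PSL211 := by
  refine ⟨expRho_PSL211, fun G _ _ => ⟨fun ⟨e⟩ => ?_, fun h => ?_⟩⟩
  · rw [expRho, expRho, prodElementOrders_congr e]
  -- Both groups are identified with the same permutation group.
  · obtain ⟨e⟩ := nonempty_mulEquiv_closure (h.trans expRho_PSL211)
    obtain ⟨f⟩ := nonempty_mulEquiv_closure expRho_PSL211
    exact ⟨e.trans f.symm⟩
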